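/- Let $E$ and $F$ be real Banach lattices such that: * $E^*$ is a KB-space, i.e. every increasing norm bounded sequence in $(E^*)_+$ is norm convergent; * $E$ has the weak$^*$ Dunford--Pettis property, i.e. $f_n(x_n)\to 0$ for every weakly null sequence $(x_n)$ in $E$ and every weak$^*$-null sequence $(f_n)$ in $E^*$; * $F$ has property (d), i.e. for every disjoint weak$^*$-null sequence $(f_n)$ in $F^*$ the sequence $(|f_n|)$ is weak$^*$-null. A bounded set $A\subseteq E$ is called limited if $\sup_{x\in A}|f_n(x)|\to 0$ for every weak$^*$-null sequence $(f_n)$ in $E^*$. A bounded set $B\subseteq F$ is called an Lwc set if every disjoint sequence in its solid hull $\bigcup_{b\in B}[-|b|,|b|]$ is norm null. A bounded linear operator $T:E\to F$ is called limitedly L-weakly compact if it maps every limited subset of $E$ to an Lwc subset of $F$. Then every positive limitedly L-weakly compact operator $T:E\to F$ is weakly compact, i.e. the image $T(B_E)$ of the closed unit ball is relatively weakly compact in $F$. -/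

import Mathlib

open Filter Topology

/-! ### The norm dual of a Banach lattice as a vector lattice

A Banach lattice `E` is given by the instances `[NormedAddCommGroup E] [NormedSpace ℝ E] [Lattice E]
[IsOrderedAddMonoid E] [IsOrderedModule ℝ E] [HasSolidNorm E] [CompleteSpace E]`.
Its norm dual `StrongDual ℝ E` carries the usual order, `f ≤ g ↔ ∀ x ≥ 0, f x ≤ g x`, and the
lattice operations are those of this order (they are built by the Riesz-Kantorovich formula). -/

namespace BanachLattice

set_option linter.unusedSectionVars false

section Dual

variable {E : Type*} [NormedAddCommGroup E] [NormedSpace ℝ E] [Lattice E]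
  [IsOrderedAddMonoid E]

/-- The usual order of the dual: `f ≤ g` iff `f x ≤ g x` for all `x ≥ 0`. -/
instance dualPartialOrder : PartialOrder (StrongDual ℝ E) where
  le f g := ∀ x : E, 0 ≤ x → f x ≤ g x
  le_refl _ _ _ := le_rfl
  le_trans _ _ _ h₁ h₂ x hx := (h₁ x hx).trans (h₂ x hx)
  le_antisymm f g h₁ h₂ := by
    have key : ∀ x : E, 0 ≤ x → f x = g x := fun x hx => le_antisymm (h₁ x hx) (h₂ x hx)
    ext x
    rw [← posPart_sub_negPart x, map_sub, map_sub, key _ (posPart_nonneg x),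
      key _ (negPart_nonneg x)]

theorem dual_le_iff {f g : StrongDual ℝ E} : f ≤ g ↔ ∀ x : E, 0 ≤ x → f x ≤ g x := Iff.rfl

instance dualIsOrderedAddMonoid : IsOrderedAddMonoid (StrongDual ℝ E) where
  add_le_add_left f g h k x hx := by
    simpa using h x hx

variable [HasSolidNorm E]

/-- `sup {f y | 0 ≤ y ≤ x}`, the value of `f⁺` at `x ≥ 0`. -/
noncomputable def conePosPart (f : StrongDual ℝ E) (x : E) : ℝ := sSup (f '' Set.Icc 0 x)

theorem conePosPart_bddAbove (f : StrongDual ℝ E) (x : E) : BddAbove (f '' Set.Icc 0 x) := by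
  refine ⟨‖f‖ * ‖x‖, ?_⟩
  rintro _ ⟨y, hy, rfl⟩
  refine (le_abs_self _).trans ((f.le_opNorm y).trans ?_)
  gcongr
  apply norm_le_norm_of_abs_le_abs
  rw [abs_of_nonneg hy.1, abs_of_nonneg (hy.1.trans hy.2)]
  exact hy.2

theorem le_conePosPart (f : StrongDual ℝ E) {x y : E} (h0 : 0 ≤ y) (hy : y ≤ x) :
    f y ≤ conePosPart f x :=
  le_csSup (conePosPart_bddAbove f x) ⟨y, ⟨h0, hy⟩, rfl⟩

theorem conePosPart_le (f : StrongDual ℝ E) {x : E} (hx : 0 ≤ x) {c : ℝ}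
    (h : ∀ y, 0 ≤ y → y ≤ x → f y ≤ c) : conePosPart f x ≤ c := by
  refine csSup_le ⟨f 0, 0, ⟨le_rfl, hx⟩, rfl⟩ ?_
  rintro _ ⟨y, hy, rfl⟩
  exact h y hy.1 hy.2

theorem conePosPart_nonneg (f : StrongDual ℝ E) {x : E} (hx : 0 ≤ x) : 0 ≤ conePosPart f x := by
  simpa using le_conePosPart f le_rfl hx

theorem conePosPart_norm_le (f : StrongDual ℝ E) {x : E} (hx : 0 ≤ x) :
    conePosPart f x ≤ ‖f‖ * ‖x‖ := by
  refine conePosPart_le f hx fun y h0 hy => (le_abs_self _).trans ((f.le_opNorm y).trans ?_)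
  gcongr
  apply norm_le_norm_of_abs_le_abs
  rwa [abs_of_nonneg h0, abs_of_nonneg hx]

theorem conePosPart_add (f : StrongDual ℝ E) {x y : E} (hx : 0 ≤ x) (hy : 0 ≤ y) :
    conePosPart f (x + y) = conePosPart f x + conePosPart f y := by
  apply le_antisymm
  · refine conePosPart_le f (add_nonneg hx hy) fun z h0 hz => ?_
    have h1 : f (z ⊓ x) ≤ conePosPart f x := le_conePosPart f (le_inf h0 hx) inf_le_right
    have h2 : f (z - z ⊓ x) ≤ conePosPart f y := by
      refine le_conePosPart f (sub_nonneg.2 inf_le_left) ?_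
      rw [sub_le_comm]
      refine le_inf (sub_le_self _ hy) ?_
      rwa [sub_le_iff_le_add]
    rw [map_sub] at h2
    linarith
  · rw [← le_sub_iff_add_le]
    refine conePosPart_le f hx fun u hu0 hu => ?_
    rw [le_sub_comm]
    refine conePosPart_le f hy fun v hv0 hv => ?_
    have := le_conePosPart f (add_nonneg hu0 hv0) (add_le_add hu hv)
    rw [map_add] at this
    linarith

/-- The positive part of a functional, as an additive map. -/
noncomputable def dualPosPartHom (f : StrongDual ℝ E) : E →+ ℝ :=
  AddMonoidHom.mk' (fun x => conePosPart f x⁺ - conePosPart f x⁻) (by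
    intro x y
    have h : (x + y)⁺ + (x⁻ + y⁻) = (x + y)⁻ + (x⁺ + y⁺) := by
      have e1 := posPart_sub_negPart (x + y)
      have e2 := posPart_sub_negPart x
      have e3 := posPart_sub_negPart y
      have e4 : (x + y)⁺ - (x + y)⁻ = (x⁺ - x⁻) + (y⁺ - y⁻) := by rw [e1, e2, e3]
      have e5 : (x + y)⁺ + (x⁻ + y⁻) - ((x + y)⁻ + (x⁺ + y⁺))
          = ((x + y)⁺ - (x + y)⁻) - ((x⁺ - x⁻) + (y⁺ - y⁻)) := by abel
      rw [← sub_eq_zero, e5, e4, sub_self]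
    have h' := congrArg (conePosPart f) h
    have p := fun z : E => posPart_nonneg z
    have n := fun z : E => negPart_nonneg z
    rw [conePosPart_add f (p _) (add_nonneg (n _) (n _)), conePosPart_add f (n _) (n _),
      conePosPart_add f (n _) (add_nonneg (p _) (p _)), conePosPart_add f (p _) (p _)] at h'
    linarith)

theorem dualPosPartHom_bound (f : StrongDual ℝ E) (x : E) :
    ‖dualPosPartHom f x‖ ≤ ‖f‖ * ‖x‖ := by
  have p := posPart_nonneg x
  have n := negPart_nonneg x
  have hp : ‖x⁺‖ ≤ ‖x‖ := by
    apply norm_le_norm_of_abs_le_abs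
    rw [abs_of_nonneg p, ← posPart_add_negPart x]
    exact le_add_of_nonneg_right n
  have hn : ‖x⁻‖ ≤ ‖x‖ := by
    apply norm_le_norm_of_abs_le_abs
    rw [abs_of_nonneg n, ← posPart_add_negPart x]
    exact le_add_of_nonneg_left p
  have h1 := conePosPart_nonneg f p
  have h2 := conePosPart_nonneg f n
  have h3 := (conePosPart_norm_le f p).trans (mul_le_mul_of_nonneg_left hp (norm_nonneg f))
  have h4 := (conePosPart_norm_le f n).trans (mul_le_mul_of_nonneg_left hn (norm_nonneg f))
  change |conePosPart f x⁺ - conePosPart f x⁻| ≤ _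
  rw [abs_le]
  constructor <;> linarith

/-- The positive part `f⁺` of `f` in the dual (Riesz-Kantorovich). -/
noncomputable def dualPosPart (f : StrongDual ℝ E) : StrongDual ℝ E :=
  (dualPosPartHom f).toRealLinearMap
    (AddMonoidHomClass.continuous_of_bound (dualPosPartHom f) ‖f‖ (dualPosPartHom_bound f))

theorem dualPosPart_apply (f : StrongDual ℝ E) {x : E} (hx : 0 ≤ x) :
    dualPosPart f x = sSup (f '' Set.Icc 0 x) := by
  change conePosPart f x⁺ - conePosPart f x⁻ = conePosPart f x
  rw [posPart_of_nonneg hx, negPart_of_nonneg hx]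
  have : conePosPart f (0 : E) = 0 := by simp [conePosPart]
  rw [this, sub_zero]

/-- The lattice structure of the dual for the order `dualPartialOrder`. -/
noncomputable instance dualLattice : Lattice (StrongDual ℝ E) where
  __ := dualPartialOrder
  sup f g := g + dualPosPart (f - g)
  inf f g := f - dualPosPart (f - g)
  le_sup_left f g x hx := by
    have h := le_conePosPart (f - g) hx le_rfl
    have e := dualPosPart_apply (f - g) hx
    change f x ≤ g x + dualPosPart (f - g) x
    rw [e]
    change f x - g x ≤ _ at h
    unfold conePosPart at h
    linarith
  le_sup_right f g x hx := by
    have h := conePosPart_nonneg (f - g) hx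
    change g x ≤ g x + dualPosPart (f - g) x
    rw [dualPosPart_apply (f - g) hx]
    exact le_add_of_nonneg_right h
  sup_le f g k hf hg x hx := by
    change g x + dualPosPart (f - g) x ≤ k x
    rw [dualPosPart_apply (f - g) hx, ← le_sub_iff_add_le']
    refine conePosPart_le (f - g) hx fun y h0 hy => ?_
    have h1 := hf y h0
    have h2 := hg (x - y) (sub_nonneg.2 hy)
    rw [map_sub, map_sub] at h2
    change f y - g y ≤ _
    linarith
  inf_le_left f g x hx := by
    have h := conePosPart_nonneg (f - g) hx
    change f x - dualPosPart (f - g) x ≤ f x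
    rw [dualPosPart_apply (f - g) hx]
    exact sub_le_self _ h
  inf_le_right f g x hx := by
    have h := le_conePosPart (f - g) hx le_rfl
    change f x - dualPosPart (f - g) x ≤ g x
    rw [dualPosPart_apply (f - g) hx]
    change f x - g x ≤ _ at h
    unfold conePosPart at h
    linarith
  le_inf k f g hf hg x hx := by
    change k x ≤ f x - dualPosPart (f - g) x
    rw [dualPosPart_apply (f - g) hx, le_sub_comm]
    refine conePosPart_le (f - g) hx fun y h0 hy => ?_
    have h1 := hg y h0
    have h2 := hf (x - y) (sub_nonneg.2 hy)
    rw [map_sub, map_sub] at h2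
    change f y - g y ≤ _
    linarith

end Dual

/-! ### Sequences -/

section Banach

variable {X : Type*} [NormedAddCommGroup X] [NormedSpace ℝ X]

/-- `x n → 0` in the weak topology `σ(X, X*)`. -/
def WeaklyNull (x : ℕ → X) : Prop :=
  Tendsto (fun n => toWeakSpace ℝ X (x n)) atTop (𝓝 0)

/-- `f n → 0` in the weak* topology `σ(X*, X)`. -/
def WeakStarNull (f : ℕ → StrongDual ℝ X) : Prop :=
  Tendsto (fun n => StrongDual.toWeakDual (f n)) atTop (𝓝 0)

/-- A bounded set on which every weak*-null sequence of functionals is uniformly null. -/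
def IsLimitedSet (A : Set X) : Prop :=
  Bornology.IsBounded A ∧
    ∀ f : ℕ → StrongDual ℝ X, WeakStarNull f →
      TendstoUniformlyOn (fun n x => f n x) (fun _ => 0) atTop A

variable (X) in
/-- The weak* Dunford-Pettis property. -/
def WeakStarDunfordPettis : Prop :=
  ∀ (x : ℕ → X) (f : ℕ → StrongDual ℝ X), WeaklyNull x → WeakStarNull f →
    Tendsto (fun n => f n (x n)) atTop (𝓝 0)

/-- The image of the closed unit ball is relatively compact in the weak topology. -/
def IsWeaklyCompactOperator {Y : Type*} [NormedAddCommGroup Y] [NormedSpace ℝ Y]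
    (T : X →L[ℝ] Y) : Prop :=
  IsCompact (closure (toWeakSpace ℝ Y '' (T '' Metric.closedBall (0 : X) 1)))

end Banach

/-- Pairwise disjoint sequences: `|x m| ⊓ |x n| = 0` for `m ≠ n`. -/
def DisjointSeq {G : Type*} [Lattice G] [AddCommGroup G] (x : ℕ → G) : Prop :=
  Pairwise fun m n => |x m| ⊓ |x n| = 0

/-- Every increasing norm bounded sequence of positive elements is norm convergent. -/
def IsKBSpace (G : Type*) [NormedAddCommGroup G] [PartialOrder G] : Prop :=
  ∀ u : ℕ → G, (∀ n, 0 ≤ u n) → Monotone u → Bornology.IsBounded (Set.range u) →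
    ∃ v : G, Tendsto u atTop (𝓝 v)

section Lattice

variable {F : Type*} [NormedAddCommGroup F] [Lattice F]

/-- A bounded set `A` such that every disjoint sequence in the solid hull
`⋃ a ∈ A, [-|a|, |a|]` is norm null. -/
def IsLwcSet (A : Set F) : Prop :=
  Bornology.IsBounded A ∧
    ∀ x : ℕ → F, (∀ n, x n ∈ ⋃ a ∈ A, Set.Icc (-|a|) |a|) → DisjointSeq x →
      Tendsto x atTop (𝓝 0)

/-- Property (d): `|f n| → 0` weak* for every disjoint weak*-null sequence `f` in the dual. -/
def PropertyD (F : Type*) [NormedAddCommGroup F] [NormedSpace ℝ F] [Lattice F]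
    [IsOrderedAddMonoid F] [HasSolidNorm F] : Prop :=
  ∀ f : ℕ → StrongDual ℝ F, DisjointSeq f → WeakStarNull f → WeakStarNull fun n => |f n|

/-- Limitedly L-weakly compact operators: limited sets are mapped to Lwc sets. -/
def IsLimitedlyLwc {X : Type*} [NormedAddCommGroup X] [NormedSpace ℝ X] [NormedSpace ℝ F]
    (T : X →L[ℝ] F) : Prop :=
  ∀ A : Set X, IsLimitedSet A → IsLwcSet (T '' A)

end Lattice

end BanachLattice

namespace BanachLattice

set_option linter.unusedSectionVars false

/-! The operator `T` turns out to be M-weakly compact, which traps the image of the ball near order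
intervals that behave like weakly compact sets.

Since `E*` is KB, the components of a positive functional carried by the partial sums of a disjoint
sequence increase to a norm limit, so bounded positive disjoint sequences are weakly null
(`IsKBSpace.tendsto_apply`). The weak* Dunford-Pettis property makes them limited, so `T` sends them
into an Lwc set, and a Kadec-Pełczyński argument (`tendsto_zero_of_norm_inf_tendsto`) gives `T (v n)
→ 0`. Consequently, for each `ε` some `u ≥ 0` satisfies `T(B_E) ⊆ [-T u, T u] + 2ε B_F`.

Singletons are limited, so disjoint sequences in `[0, 2 T u]` are norm null. On such an interval
monotone sequences converge, and one positive functional controls the norm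
(`IntervalDisjointNull.exists_dominating_functional`). Composed with a lattice version of `a² / w`,
it becomes a quantitatively convex function, whose near-minimisers provide an approximate norm
cluster point for any directed family of nonempty convex subsets
(`IntervalDisjointNull.exists_approx_cluster`). Applied to convex sets approximating a weak* cluster
point `ξ ∈ F**` of `T(B_E)`, this puts `ξ` within `3ε` of `F`, hence in `F`. -/

theorem exists_seq_of_list_history {α : Type*} {R : List α → α → Prop}
    (h : ∀ l, ∃ y, R l y) : ∃ x : ℕ → α, ∀ n, R ((List.range n).map x) (x n) := by
  choose g hg using h
  -- Dependent choice with full memory: `L n` lists the first `n` chosen terms.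
  let L : ℕ → List α := fun n => Nat.rec [] (fun _ l => l ++ [g l]) n
  have hL : ∀ n, L n = (List.range n).map fun k => g (L k) := by
    intro n
    induction n with
    | zero => rfl
    | succ k ih =>
      rw [List.range_succ, List.map_append, ← ih]
      rfl
  refine ⟨fun n => g (L n), fun n => ?_⟩
  rw [← hL n]
  exact hg (L n)

/-! ### Disjointification and monotone sequences in order intervals -/

section VectorLattice

variable {F : Type*} [NormedAddCommGroup F] [NormedSpace ℝ F] [Lattice F] [IsOrderedAddMonoid F]
  [IsOrderedModule ℝ F]

theorem inf_eq_zero_of_inf_smul_le {a b p q : F} {c : ℝ} (hc : 1 ≤ c) (ha : 0 ≤ a) (hb : 0 ≤ b)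
    (hp : 0 ≤ p) (hap : a ≤ p) (hbq : b ≤ c • q) (hpq : p ⊓ q = 0) : a ⊓ b = 0 := by
  refine le_antisymm ?_ (le_inf ha hb)
  have hc0 : 0 < c := by linarith
  have hi : c⁻¹ ≤ 1 := inv_le_one_of_one_le₀ hc
  have h1 : c⁻¹ • (a ⊓ b) ≤ p :=
    calc c⁻¹ • (a ⊓ b) ≤ c⁻¹ • p :=
          smul_le_smul_of_nonneg_left (inf_le_left.trans hap) (inv_nonneg.2 hc0.le)
      _ ≤ (1 : ℝ) • p := smul_le_smul_of_nonneg_right hi hp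
      _ = p := one_smul _ _
  have h2 : c⁻¹ • (a ⊓ b) ≤ q :=
    calc c⁻¹ • (a ⊓ b) ≤ c⁻¹ • c • q :=
          smul_le_smul_of_nonneg_left (inf_le_right.trans hbq) (inv_nonneg.2 hc0.le)
      _ = q := inv_smul_smul₀ hc0.ne' q
  have h3 : c⁻¹ • (a ⊓ b) ≤ 0 := hpq ▸ le_inf h1 h2
  have h4 := smul_le_smul_of_nonneg_left h3 hc0.le
  rwa [smul_inv_smul₀ hc0.ne', smul_zero] at h4

/-- A disjoint sequence below `x`, provided `x n ≤ 2 ^ n • v`. -/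
noncomputable def disjointify (v : F) (x : ℕ → F) (n : ℕ) : F :=
  (x n - (4 ^ n : ℝ) • ∑ i ∈ Finset.range n, x i - ((2 : ℝ)⁻¹ ^ n) • v)⁺

theorem disjointify_nonneg (v : F) (x : ℕ → F) (n : ℕ) : 0 ≤ disjointify v x n :=
  posPart_nonneg _

theorem disjointify_le {v : F} {x : ℕ → F} (hv : 0 ≤ v) (hx : ∀ n, 0 ≤ x n) (n : ℕ) :
    disjointify v x n ≤ x n := by
  refine sup_le ?_ (hx n)
  rw [sub_sub]
  refine sub_le_self _ (add_nonneg (smul_nonneg (by positivity) (Finset.sum_nonneg fun i _ => hx i))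
    (smul_nonneg (by positivity) hv))

/-- For `m < n` put `a = x m - 2⁻ⁿ v`. Term `m` lies below `a⁺`. Since `x n ≤ 2ⁿ v = 4ⁿ 2⁻ⁿ v` and
the subtracted sum contains `x m`, term `n` lies below `4ⁿ a⁻`. This is where the factor `4ⁿ` comes
from. -/
theorem disjointSeq_disjointify {v : F} {x : ℕ → F} (hv : 0 ≤ v) (hx : ∀ n, 0 ≤ x n)
    (hxv : ∀ n, x n ≤ (2 ^ n : ℝ) • v) : DisjointSeq (disjointify v x) := by
  have key : ∀ m n, m < n → disjointify v x m ⊓ disjointify v x n = 0 := by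
    intro m n hmn
    refine inf_eq_zero_of_inf_smul_le (c := 4 ^ n) (one_le_pow₀ (by norm_num))
      (posPart_nonneg _) (posPart_nonneg _)
      (posPart_nonneg (x m - ((2 : ℝ)⁻¹ ^ n) • v)) (posPart_mono ?_) ?_
      (posPart_inf_negPart_eq_zero _)
    · rw [sub_sub]
      refine sub_le_sub_left ?_ _
      refine le_add_of_nonneg_of_le
        (smul_nonneg (by positivity) (Finset.sum_nonneg fun i _ => hx i)) ?_
      exact smul_le_smul_of_nonneg_right
        (pow_le_pow_of_le_one (by norm_num) (by norm_num) hmn.le) hv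
    · refine sup_le ?_ (smul_nonneg (by positivity) (negPart_nonneg _))
      have h1 : x m ≤ ∑ i ∈ Finset.range n, x i :=
        Finset.single_le_sum (fun i _ => hx i) (Finset.mem_range.2 hmn)
      have h4 : (0 : ℝ) ≤ 4 ^ n := by positivity
      have h2 : (4 ^ n : ℝ) • (-(x m - ((2 : ℝ)⁻¹ ^ n) • v))
          ≤ (4 ^ n : ℝ) • (x m - ((2 : ℝ)⁻¹ ^ n) • v)⁻ :=
        smul_le_smul_of_nonneg_left (neg_le_negPart _) h4
      refine le_trans ?_ h2
      have e : (4 : ℝ) ^ n * 2⁻¹ ^ n = 2 ^ n := by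
        rw [← mul_pow]; norm_num
      rw [neg_sub, smul_sub, smul_smul, e]
      refine (sub_le_self _ (smul_nonneg (by positivity) hv)).trans ?_
      exact sub_le_sub (hxv n) (smul_le_smul_of_nonneg_left h1 h4)
  intro m n hmn
  rw [abs_of_nonneg (disjointify_nonneg _ _ _), abs_of_nonneg (disjointify_nonneg _ _ _)]
  rcases Nat.lt_or_gt_of_ne hmn with h | h
  · exact key m n h
  · rw [inf_comm]; exact key n m h

variable [HasSolidNorm F]

theorem norm_le_norm_of_nonneg_of_le {a b : F} (ha : 0 ≤ a) (h : a ≤ b) : ‖a‖ ≤ ‖b‖ :=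
  norm_le_norm_of_abs_le_abs (by rwa [abs_of_nonneg ha, abs_of_nonneg (ha.trans h)])

theorem inf_add_le_inf_add_inf {a b c : F} (ha : 0 ≤ a) (hb : 0 ≤ b) (hc : 0 ≤ c) :
    a ⊓ (b + c) ≤ a ⊓ b + a ⊓ c := by
  have h1 : a ⊓ (b + c) ≤ a + a ⊓ c :=
    inf_le_left.trans (le_add_of_nonneg_right (le_inf ha hc))
  have h2 : a ⊓ (b + c) ≤ b + a ⊓ c := by
    rw [add_inf]
    exact le_inf (inf_le_left.trans (le_add_of_nonneg_left hb)) inf_le_right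
  rw [inf_add]
  exact le_inf h1 h2

theorem norm_inf_add_le {a b c : F} (ha : 0 ≤ a) (hb : 0 ≤ b) (hc : 0 ≤ c) :
    ‖a ⊓ (b + c)‖ ≤ ‖a ⊓ b‖ + ‖a ⊓ c‖ :=
  (norm_le_norm_of_nonneg_of_le (le_inf ha (add_nonneg hb hc))
    (inf_add_le_inf_add_inf ha hb hc)).trans (norm_add_le _ _)

theorem norm_inf_sum_le {ι : Type*} {a : F} (ha : 0 ≤ a) {b : ι → F} (hb : ∀ i, 0 ≤ b i)
    (s : Finset ι) : ‖a ⊓ ∑ i ∈ s, b i‖ ≤ ∑ i ∈ s, ‖a ⊓ b i‖ := by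
  classical
  induction s using Finset.induction_on with
  | empty => simp [inf_eq_right.2 ha]
  | insert i s hi ih =>
    rw [Finset.sum_insert hi, Finset.sum_insert hi]
    exact (norm_inf_add_le ha (hb i) (Finset.sum_nonneg fun j _ => hb j)).trans (by gcongr)

theorem norm_inf_smul_le {a b : F} (ha : 0 ≤ a) (hb : 0 ≤ b) {c : ℝ} (hc : 1 ≤ c) :
    ‖a ⊓ c • b‖ ≤ c * ‖a ⊓ b‖ := by
  have hc0 : 0 < c := by linarith
  have h : a ⊓ c • b ≤ c • (a ⊓ b) := by
    have h' : c⁻¹ • (a ⊓ c • b) ≤ a ⊓ b := by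
      refine le_inf ?_ ?_
      · calc c⁻¹ • (a ⊓ c • b) ≤ c⁻¹ • a :=
              smul_le_smul_of_nonneg_left inf_le_left (inv_nonneg.2 hc0.le)
          _ ≤ (1 : ℝ) • a := smul_le_smul_of_nonneg_right (inv_le_one_of_one_le₀ hc) ha
          _ = a := one_smul _ _
      · calc c⁻¹ • (a ⊓ c • b) ≤ c⁻¹ • c • b :=
              smul_le_smul_of_nonneg_left inf_le_right (inv_nonneg.2 hc0.le)
          _ = b := inv_smul_smul₀ hc0.ne' b
    have := smul_le_smul_of_nonneg_left h' hc0.le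
    rwa [smul_inv_smul₀ hc0.ne'] at this
  calc ‖a ⊓ c • b‖ ≤ ‖c • (a ⊓ b)‖ :=
        norm_le_norm_of_nonneg_of_le (le_inf ha (smul_nonneg hc0.le hb)) h
    _ = c * ‖a ⊓ b‖ := by rw [norm_smul, Real.norm_of_nonneg hc0.le]

/-- What disjointification removes from `x n` is exactly `x n ⊓ (4ⁿ ∑ x i + 2⁻ⁿ v)`, and the meet is
subadditive in its second argument. -/
theorem norm_le_norm_disjointify_add {v : F} {x : ℕ → F} (hv : 0 ≤ v) (hx : ∀ n, 0 ≤ x n)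
    (n : ℕ) : ‖x n‖ ≤ ‖disjointify v x n‖ + 4 ^ n * ∑ i ∈ Finset.range n, ‖x n ⊓ x i‖
      + 2⁻¹ ^ n * ‖v‖ := by
  set S := ∑ i ∈ Finset.range n, x i
  have hS : 0 ≤ S := Finset.sum_nonneg fun i _ => hx i
  have hS4 : 0 ≤ (4 ^ n : ℝ) • S := smul_nonneg (by positivity) hS
  have hv2 : 0 ≤ ((2 : ℝ)⁻¹ ^ n) • v := smul_nonneg (by positivity) hv
  have e : x n = disjointify v x n + x n ⊓ ((4 ^ n : ℝ) • S + ((2 : ℝ)⁻¹ ^ n) • v) := by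
    have h : disjointify v x n = x n - x n ⊓ ((4 ^ n : ℝ) • S + ((2 : ℝ)⁻¹ ^ n) • v) := by
      change (x n - (4 ^ n : ℝ) • S - ((2 : ℝ)⁻¹ ^ n) • v)⁺ = _
      rw [sub_sub, sub_inf, sub_self, sup_comm]
      rfl
    rw [h, sub_add_cancel]
  have h1 : ‖x n ⊓ (4 ^ n : ℝ) • S‖ ≤ 4 ^ n * ∑ i ∈ Finset.range n, ‖x n ⊓ x i‖ :=
    (norm_inf_smul_le (hx n) hS (one_le_pow₀ (by norm_num))).trans
      (mul_le_mul_of_nonneg_left (norm_inf_sum_le (hx n) hx _) (by positivity))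
  have h2 : ‖x n ⊓ ((2 : ℝ)⁻¹ ^ n) • v‖ ≤ 2⁻¹ ^ n * ‖v‖ := by
    refine (norm_le_norm_of_nonneg_of_le (le_inf (hx n) hv2) inf_le_right).trans ?_
    rw [norm_smul, Real.norm_of_nonneg (by positivity)]
  have h3 := norm_inf_add_le (hx n) hS4 hv2
  calc ‖x n‖ ≤ ‖disjointify v x n‖ + ‖x n ⊓ ((4 ^ n : ℝ) • S + ((2 : ℝ)⁻¹ ^ n) • v)‖ := by
        conv_lhs => rw [e]
        exact norm_add_le _ _
    _ ≤ _ := by linarith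

theorem exists_majorant [CompleteSpace F] {x : ℕ → F} (hx : ∀ n, 0 ≤ x n) {C : ℝ}
    (hC : ∀ n, ‖x n‖ ≤ C) : ∃ v : F, 0 ≤ v ∧ ∀ n, x n ≤ (2 ^ n : ℝ) • v := by
  have hs : Summable fun n => ((2 : ℝ)⁻¹ ^ n) • x n := by
    refine Summable.of_norm_bounded (g := fun n => (2 : ℝ)⁻¹ ^ n * C)
      ((summable_geometric_of_lt_one (by norm_num) (by norm_num)).mul_right C) fun n => ?_
    rw [norm_smul, Real.norm_of_nonneg (by positivity)]
    exact mul_le_mul_of_nonneg_left (hC n) (by positivity)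
  have h0 : ∀ n, 0 ≤ ((2 : ℝ)⁻¹ ^ n) • x n := fun n => smul_nonneg (by positivity) (hx n)
  refine ⟨∑' n, ((2 : ℝ)⁻¹ ^ n) • x n, tsum_nonneg h0, fun n => ?_⟩
  have h1 := hs.le_tsum n fun j _ => h0 j
  have h2 := smul_le_smul_of_nonneg_left h1 (by positivity : (0 : ℝ) ≤ 2 ^ n)
  rwa [smul_smul, ← mul_pow, mul_inv_cancel₀ two_ne_zero, one_pow, one_smul] at h2

/-- A Kadec-Pełczyński type principle. -/
theorem tendsto_zero_of_norm_inf_tendsto [CompleteSpace F] {x : ℕ → F} (hx : ∀ n, 0 ≤ x n)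
    {C : ℝ} (hC : ∀ n, ‖x n‖ ≤ C)
    (hinf : ∀ i, Tendsto (fun n => ‖x n ⊓ x i‖) atTop (𝓝 0))
    (hdisj : ∀ (φ : ℕ → ℕ) (y : ℕ → F), (∀ n, 0 ≤ y n) → (∀ n, y n ≤ x (φ n)) →
      DisjointSeq y → Tendsto y atTop (𝓝 0)) : Tendsto x atTop (𝓝 0) := by
  by_contra hnot
  rw [tendsto_zero_iff_norm_tendsto_zero, Metric.tendsto_atTop] at hnot
  push Not at hnot
  obtain ⟨ε, hε, hbig⟩ := hnot
  -- The length of `l` is the index `n` of the term being chosen. The `n` meets with earlier terms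
  -- then add up to at most `8⁻ⁿ`, which the factor `4ⁿ` of the disjointification turns into `2⁻ⁿ`.
  let R : List ℕ → ℕ → Prop := fun l y =>
    ε ≤ ‖x y‖ ∧ ∀ i ∈ l, ‖x y ⊓ x i‖ ≤ (8 : ℝ)⁻¹ ^ l.length / (l.length + 1)
  obtain ⟨φ, hφ⟩ := exists_seq_of_list_history (R := R) (by
    intro l
    have hev : ∀ᶠ n in atTop, ∀ i ∈ l, ‖x n ⊓ x i‖ ≤ (8 : ℝ)⁻¹ ^ l.length / (l.length + 1) := by
      have : ∀ᶠ n in atTop, ∀ i ∈ l.toFinset,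
          ‖x n ⊓ x i‖ ≤ (8 : ℝ)⁻¹ ^ l.length / (l.length + 1) := by
        rw [Finset.eventually_all]
        intro i _
        exact (hinf i).eventually_le_const (by positivity)
      simpa using this
    obtain ⟨N, hN⟩ := eventually_atTop.1 hev
    obtain ⟨n, hn, hn'⟩ := hbig N
    refine ⟨n, ?_, hN n hn⟩
    simpa using hn')
  have hφ0 : ∀ n, 0 ≤ x (φ n) := fun n => hx _
  obtain ⟨v, hv, hxv⟩ := exists_majorant (x := fun n => x (φ n)) hφ0 fun n => hC _
  have ht := hdisj φ (disjointify v fun n => x (φ n)) (disjointify_nonneg _ _)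
    (disjointify_le hv hφ0) (disjointSeq_disjointify hv hφ0 hxv)
  have hlim : Tendsto (fun n => ‖disjointify v (fun n => x (φ n)) n‖ + (2 : ℝ)⁻¹ ^ n
      + 2⁻¹ ^ n * ‖v‖) atTop (𝓝 0) := by
    have h2 : Tendsto (fun n : ℕ => (2 : ℝ)⁻¹ ^ n) atTop (𝓝 0) :=
      tendsto_pow_atTop_nhds_zero_of_lt_one (by norm_num) (by norm_num)
    simpa using (ht.norm.add h2).add (h2.mul_const ‖v‖)
  have hle : ∀ n, ε ≤ ‖disjointify v (fun n => x (φ n)) n‖ + (2 : ℝ)⁻¹ ^ n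
      + 2⁻¹ ^ n * ‖v‖ := by
    intro n
    obtain ⟨h1, h2⟩ := hφ n
    refine h1.trans ((norm_le_norm_disjointify_add hv hφ0 n).trans ?_)
    gcongr
    have h3 : ∑ i ∈ Finset.range n, ‖x (φ n) ⊓ x (φ i)‖ ≤ 8⁻¹ ^ n := by
      calc ∑ i ∈ Finset.range n, ‖x (φ n) ⊓ x (φ i)‖
          ≤ ∑ i ∈ Finset.range n, (8 : ℝ)⁻¹ ^ n / (n + 1) := by
            refine Finset.sum_le_sum fun i hi => ?_
            have := h2 (φ i) (List.mem_map.2 ⟨i, List.mem_range.2 (Finset.mem_range.1 hi), rfl⟩)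
            simpa using this
        _ = n * ((8 : ℝ)⁻¹ ^ n / (n + 1)) := by simp
        _ = (n / (n + 1)) * 8⁻¹ ^ n := by ring
        _ ≤ 1 * 8⁻¹ ^ n := by
            gcongr
            rw [div_le_one (by positivity)]
            linarith
        _ = 8⁻¹ ^ n := one_mul _
    calc (4 : ℝ) ^ n * ∑ i ∈ Finset.range n, ‖x (φ n) ⊓ x (φ i)‖ ≤ 4 ^ n * 8⁻¹ ^ n := by gcongr
      _ = 2⁻¹ ^ n := by rw [← mul_pow]; norm_num
  exact absurd (ge_of_tendsto' hlim hle) (not_le.2 hε)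

/-- Every disjoint sequence in the order interval `[0, v]` is norm null. -/
def IntervalDisjointNull (v : F) : Prop :=
  ∀ y : ℕ → F, (∀ n, 0 ≤ y n) → (∀ n, y n ≤ v) → DisjointSeq y → Tendsto y atTop (𝓝 0)

/-- Induction on the number of terms whose meet must vanish. Meeting the sequence with a fixed `z i`
lowers that number by one, so these meets tend to zero, and the Kadec-Pełczyński principle applies.
-/
theorem IntervalDisjointNull.tendsto_zero_of_card_inf [CompleteSpace F] {v : F}
    (hv : IntervalDisjointNull v) (K : ℕ) : ∀ z : ℕ → F, (∀ n, 0 ≤ z n) → (∀ n, z n ≤ v) →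
      (∀ s : Finset ℕ, s.card = K + 1 → ∀ w : F, (∀ i ∈ s, w ≤ z i) → w ≤ 0) →
      Tendsto z atTop (𝓝 0) := by
  induction K with
  | zero =>
    intro z h0 _ h
    have : z = fun _ => 0 := by
      funext n
      exact le_antisymm (h {n} rfl (z n) (by simp)) (h0 n)
    rw [this]
    exact tendsto_const_nhds
  | succ K ih =>
    intro z h0 hzv h
    refine tendsto_zero_of_norm_inf_tendsto h0
      (fun n => norm_le_norm_of_nonneg_of_le (h0 n) (hzv n)) (fun i => ?_)
      fun φ y hy0 hy hdy => hv y hy0 (fun n => (hy n).trans (hzv _)) hdy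
    -- The entry at `i` is set to zero, since `z i ⊓ z i = z i` need not satisfy the induction
    -- hypothesis.
    have hw := ih (fun j => if j = i then 0 else z j ⊓ z i)
      (fun j => by split_ifs; exacts [le_rfl, le_inf (h0 _) (h0 _)])
      (fun j => by split_ifs; exacts [(h0 0).trans (hzv 0), inf_le_left.trans (hzv _)]) ?_
    · refine (tendsto_zero_iff_norm_tendsto_zero.1 hw).congr' ?_
      filter_upwards [eventually_gt_atTop i] with j hj
      rw [if_neg hj.ne']
    · intro s hs w hsw
      by_cases hi : i ∈ s
      · simpa using hsw i hi
      · refine h (insert i s) (by rw [Finset.card_insert_of_notMem hi, hs]) w fun j hj => ?_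
        have hle : ∀ j ∈ s, w ≤ z j ⊓ z i := fun j hj => by
          have := hsw j hj
          rwa [if_neg (ne_of_mem_of_not_mem hj hi)] at this
        rcases Finset.mem_insert.1 hj with rfl | hj
        · obtain ⟨k, hk⟩ := Finset.card_pos.1 (by omega : 0 < s.card)
          exact (hle k hk).trans inf_le_right
        · exact (hle j hj).trans inf_le_left

/-- The meet `m` of `K + 1` terms satisfies `(K + 1) m ≤ v`, so the truncations `(d n - δ v)⁺` with
`δ = 1 / (K + 1)` have vanishing meets of `K + 1` terms. The truncation costs at most `δ ‖v‖ < ε /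
2`. -/
theorem IntervalDisjointNull.tendsto_zero_of_sum_le [CompleteSpace F] {v : F}
    (hv : IntervalDisjointNull v) {d : ℕ → F} (h0 : ∀ n, 0 ≤ d n)
    (hd : ∀ s : Finset ℕ, ∑ i ∈ s, d i ≤ v) : Tendsto d atTop (𝓝 0) := by
  have hv0 : 0 ≤ v := by simpa using hd ∅
  have hdv : ∀ n, d n ≤ v := fun n => by simpa using hd {n}
  rw [Metric.tendsto_atTop]
  intro ε hε
  obtain ⟨K, hK⟩ := exists_nat_gt (2 * ‖v‖ / ε)
  set δ : ℝ := ((K : ℝ) + 1)⁻¹ with hδ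
  have hδ0 : 0 ≤ δ := by positivity
  have hδv : 0 ≤ δ • v := smul_nonneg hδ0 hv0
  have ht := hv.tendsto_zero_of_card_inf K (fun n => (d n - δ • v)⁺) (fun n => posPart_nonneg _)
    (fun n => sup_le ((sub_le_self _ hδv).trans (hdv n)) hv0) (by
      intro s hs w hw
      have hne : s.Nonempty := Finset.card_pos.1 (by omega)
      set m := s.inf' hne d
      have h1 : w ≤ (m - δ • v)⁺ := by
        -- Truncation commutes with finite meets because a vector lattice is distributive.
        have hcomp := Finset.apply_inf'_eq_inf'_comp hne (f := d) (fun x : F => (x - δ • v)⁺)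
          (fun x y => by
            change (x ⊓ y - δ • v) ⊔ 0 = ((x - δ • v) ⊔ 0) ⊓ ((y - δ • v) ⊔ 0)
            let _ := AddCommGroup.toDistribLattice F
            rw [inf_sub, sup_inf_right])
        change w ≤ (s.inf' hne d - δ • v)⁺
        rw [hcomp]
        exact Finset.le_inf' _ _ hw
      have h2 : ((K : ℝ) + 1) • m ≤ v := by
        refine le_trans ?_ (hd s)
        have := Finset.card_nsmul_le_sum s d m fun i hi => Finset.inf'_le d hi
        rw [hs, ← Nat.cast_smul_eq_nsmul ℝ] at this
        exact_mod_cast this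
      have h3 : m ≤ δ • v := by
        have := smul_le_smul_of_nonneg_left h2 hδ0
        rwa [smul_smul, hδ, inv_mul_cancel₀ (by positivity), one_smul] at this
      rwa [posPart_of_nonpos (sub_nonpos.2 h3)] at h1)
  obtain ⟨N, hN⟩ := Metric.tendsto_atTop.1 ht (ε / 2) (by linarith)
  refine ⟨N, fun n hn => ?_⟩
  have h1 := hN n hn
  rw [dist_zero_right] at h1 ⊢
  have h2 : d n ≤ (d n - δ • v)⁺ + δ • v := by
    rw [← sub_le_iff_le_add]; exact le_posPart _
  have h3 := (norm_le_norm_of_nonneg_of_le (h0 n) h2).trans (norm_add_le _ _)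
  rw [norm_smul, Real.norm_of_nonneg hδ0] at h3
  have h4 : δ * ‖v‖ < ε / 2 := by
    rw [div_lt_iff₀ hε] at hK
    rw [hδ, inv_mul_lt_iff₀ (by positivity)]
    nlinarith
  linarith

/-- A non-Cauchy increasing sequence has successive increments of norm at least `ε`, whose finite
sums telescope below `v`. -/
theorem IntervalDisjointNull.exists_tendsto_of_monotone [CompleteSpace F] {v : F}
    (hv : IntervalDisjointNull v) {x : ℕ → F} (hx : Monotone x) (h0 : ∀ n, 0 ≤ x n)
    (hxv : ∀ n, x n ≤ v) : ∃ y, Tendsto x atTop (𝓝 y) := by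
  refine cauchySeq_tendsto_of_complete ?_
  by_contra hnot
  rw [Metric.cauchySeq_iff'] at hnot
  push Not at hnot
  obtain ⟨ε, hε, hbig⟩ := hnot
  choose g hg hg' using hbig
  let φ : ℕ → ℕ := fun n => g^[n] 0
  have hs : ∀ n, φ (n + 1) = g (φ n) := fun n => Function.iterate_succ_apply' g n 0
  have hφ : Monotone φ := monotone_nat_of_le_succ fun n => by rw [hs]; exact hg _
  let d : ℕ → F := fun n => x (φ (n + 1)) - x (φ n)
  have hd0 : ∀ n, 0 ≤ d n := fun n => sub_nonneg.2 (hx (hφ n.le_succ))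
  have ht := hv.tendsto_zero_of_sum_le hd0 (by
    intro s
    obtain ⟨N, hN⟩ := s.exists_nat_subset_range
    refine (Finset.sum_le_sum_of_subset_of_nonneg hN fun i _ _ => hd0 i).trans ?_
    rw [Finset.sum_range_sub (fun n => x (φ n))]
    exact (sub_le_self _ (h0 _)).trans (hxv _))
  obtain ⟨N, hN⟩ := Metric.tendsto_atTop.1 ht ε hε
  have h1 := hN N le_rfl
  have h2 := hg' (φ N)
  rw [dist_zero_right] at h1
  rw [dist_eq_norm, ← hs] at h2
  exact absurd h1 (not_lt.2 h2)

end VectorLattice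

/-! ### Norm control by a positive functional and approximate cluster points -/

section PositiveFunctionals

variable {F : Type*} [NormedAddCommGroup F] [NormedSpace ℝ F] [Lattice F] [IsOrderedAddMonoid F]

theorem map_le_map_of_nonneg {f : StrongDual ℝ F} (hf : 0 ≤ f) {x y : F} (h : x ≤ y) :
    f x ≤ f y := by
  have h1 : 0 ≤ f (y - x) := hf _ (sub_nonneg.2 h)
  rw [map_sub] at h1
  linarith

variable [HasSolidNorm F]

theorem dualPosPart_nonneg (f : StrongDual ℝ F) : 0 ≤ dualPosPart f := fun x hx => by
  rw [dualPosPart_apply f hx]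
  exact conePosPart_nonneg f hx

theorem le_dualPosPart (f : StrongDual ℝ F) : f ≤ dualPosPart f := fun x hx => by
  rw [dualPosPart_apply f hx]
  exact le_conePosPart f hx le_rfl

theorem norm_dualPosPart_le (f : StrongDual ℝ F) : ‖dualPosPart f‖ ≤ ‖f‖ :=
  ContinuousLinearMap.opNorm_le_bound _ (norm_nonneg f) (dualPosPartHom_bound f)

theorem exists_nonneg_dual_vector {z : F} (hz : 0 ≤ z) :
    ∃ f : StrongDual ℝ F, 0 ≤ f ∧ ‖f‖ ≤ 1 ∧ ‖z‖ ≤ f z := by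
  obtain ⟨g, hg, hgz⟩ := exists_dual_vector'' ℝ z
  exact ⟨dualPosPart g, dualPosPart_nonneg g, (norm_dualPosPart_le g).trans hg,
    hgz.symm.le.trans (le_dualPosPart g z hz)⟩

theorem exists_dual_upperBound (l : List (StrongDual ℝ F)) :
    ∃ φ : StrongDual ℝ F, 0 ≤ φ ∧ ∀ f ∈ l, f ≤ φ := by
  induction l with
  | nil => exact ⟨0, le_rfl, by simp⟩
  | cons g l ih =>
    obtain ⟨φ, h0, h⟩ := ih
    refine ⟨φ ⊔ g, h0.trans le_sup_left, fun f hf => ?_⟩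
    rcases List.mem_cons.1 hf with rfl | hf
    · exact le_sup_right
    · exact (h f hf).trans le_sup_left

variable [IsOrderedModule ℝ F]

theorem sum_Ico_inv_two_pow_le (m n : ℕ) : ∑ i ∈ Finset.Ico m n, (2 : ℝ)⁻¹ ^ i ≤ 2 * 2⁻¹ ^ m := by
  rcases le_total m n with h | h
  · rw [geom_sum_Ico (by norm_num) h]
    have : (0 : ℝ) ≤ 2⁻¹ ^ n := by positivity
    rw [div_le_iff_of_neg (by norm_num)]
    linarith
  · rw [Finset.Ico_eq_empty_of_le h]
    simp

/-- Otherwise there are `z n` in `[0, v]` and norming `f n ≥ 0` with `f n (z n) ≥ ε` and `f k (z n)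
≤ 2⁻ⁿ` for `k < n`. The suprema `t m` of the tails decrease in norm to a limit on which every `f k`
is at most zero, so `ε ≤ f n (t n - lim t) → 0`. -/
theorem IntervalDisjointNull.exists_dominating_functional [CompleteSpace F] {v : F}
    (hv : IntervalDisjointNull v) {ε : ℝ} (hε : 0 < ε) :
    ∃ φ : StrongDual ℝ F, 0 ≤ φ ∧ ∃ δ > 0, ∀ z, 0 ≤ z → z ≤ v → φ z < δ → ‖z‖ < ε := by
  by_contra! hnot
  let R : List (F × StrongDual ℝ F) → F × StrongDual ℝ F → Prop := fun l p =>
    0 ≤ p.1 ∧ p.1 ≤ v ∧ 0 ≤ p.2 ∧ ‖p.2‖ ≤ 1 ∧ ε ≤ p.2 p.1 ∧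
      ∀ q ∈ l, q.2 p.1 ≤ (2 : ℝ)⁻¹ ^ l.length
  obtain ⟨p, hp⟩ := exists_seq_of_list_history (R := R) (by
    intro l
    -- One upper bound of all earlier functionals makes them small on the new vector simultaneously.
    obtain ⟨φ, hφ, hl⟩ := exists_dual_upperBound (l.map Prod.snd)
    obtain ⟨z, hz0, hzv, hzφ, hzε⟩ := hnot φ hφ ((2 : ℝ)⁻¹ ^ l.length) (by positivity)
    obtain ⟨f, hf0, hf1, hfz⟩ := exists_nonneg_dual_vector hz0
    exact ⟨(z, f), hz0, hzv, hf0, hf1, hzε.trans hfz, fun q hq =>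
      (hl q.2 (List.mem_map_of_mem hq) z hz0).trans hzφ.le⟩)
  let z : ℕ → F := fun n => (p n).1
  let f : ℕ → StrongDual ℝ F := fun n => (p n).2
  have hz0 : ∀ n, 0 ≤ z n := fun n => (hp n).1
  have hzv : ∀ n, z n ≤ v := fun n => (hp n).2.1
  have hf0 : ∀ n, 0 ≤ f n := fun n => (hp n).2.2.1
  have hf1 : ∀ n, ‖f n‖ ≤ 1 := fun n => (hp n).2.2.2.1
  have hfz : ∀ n, ε ≤ f n (z n) := fun n => (hp n).2.2.2.2.1
  have hsmall : ∀ k n, k < n → f k (z n) ≤ (2 : ℝ)⁻¹ ^ n := fun k n hkn => by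
    have := (hp n).2.2.2.2.2 (p k) (List.mem_map.2 ⟨k, List.mem_range.2 hkn, rfl⟩)
    simpa using this
  have hex : ∀ m, ∃ t, Tendsto (fun n => partialSups (fun i => z (m + i)) n) atTop (𝓝 t) :=
    fun m => hv.exists_tendsto_of_monotone (partialSups _).monotone
      (fun n => (hz0 _).trans (le_partialSups_of_le (fun i => z (m + i)) (Nat.zero_le n)))
      (fun n => partialSups_le _ _ _ fun j _ => hzv _)
  choose t ht using hex
  have hle : ∀ m i, z (m + i) ≤ t m := fun m i =>
    ge_of_tendsto (ht m) (by
      filter_upwards [eventually_ge_atTop i] with n hn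
      exact le_partialSups_of_le (fun i => z (m + i)) hn)
  have ht_le : ∀ m c, (∀ i, z (m + i) ≤ c) → t m ≤ c := fun m c hc =>
    le_of_tendsto' (ht m) fun n => partialSups_le _ _ _ fun j _ => hc j
  have hzt : ∀ m, z m ≤ t m := fun m => hle m 0
  have ht0 : ∀ m, 0 ≤ t m := fun m => (hz0 m).trans (hzt m)
  have htv : ∀ m, t m ≤ v := fun m => ht_le m v fun i => hzv _
  have hanti : Antitone t := antitone_nat_of_succ_le fun m => ht_le _ _ fun i => by
    have := hle m (1 + i)
    rwa [← add_assoc] at this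
  obtain ⟨s, hs⟩ := hv.exists_tendsto_of_monotone (x := fun m => v - t m)
    (fun a b hab => sub_le_sub_left (hanti hab) v) (fun m => sub_nonneg.2 (htv m))
    (fun m => sub_le_self _ (ht0 m))
  have htlim : Tendsto t atTop (𝓝 (v - s)) := by
    simpa using (tendsto_const_nhds (x := v)).sub hs
  have hft : ∀ k m, k < m → f k (t m) ≤ 2 * 2⁻¹ ^ m := fun k m hkm => by
    refine le_of_tendsto' (((f k).continuous.tendsto _).comp (ht m)) fun n => ?_
    have h1 : partialSups (fun i => z (m + i)) n ≤ ∑ i ∈ Finset.Ico m (m + n + 1), z i :=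
      partialSups_le _ _ _ fun j hj =>
        Finset.single_le_sum (f := z) (fun i _ => hz0 i) (Finset.mem_Ico.2 ⟨by omega, by omega⟩)
    calc f k (partialSups (fun i => z (m + i)) n)
        ≤ f k (∑ i ∈ Finset.Ico m (m + n + 1), z i) := map_le_map_of_nonneg (hf0 k) h1
      _ = ∑ i ∈ Finset.Ico m (m + n + 1), f k (z i) := map_sum _ _ _
      _ ≤ ∑ i ∈ Finset.Ico m (m + n + 1), (2 : ℝ)⁻¹ ^ i := Finset.sum_le_sum fun i hi =>
          hsmall k i (hkm.trans_le (Finset.mem_Ico.1 hi).1)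
      _ ≤ _ := sum_Ico_inv_two_pow_le _ _
  have hflim : ∀ k, f k (v - s) ≤ 0 := fun k => by
    have h2 : Tendsto (fun m : ℕ => 2 * (2 : ℝ)⁻¹ ^ m) atTop (𝓝 0) := by
      simpa using (tendsto_pow_atTop_nhds_zero_of_lt_one (r := (2 : ℝ)⁻¹) (by norm_num)
        (by norm_num)).const_mul 2
    refine le_of_tendsto_of_tendsto (((f k).continuous.tendsto _).comp htlim) h2 ?_
    filter_upwards [eventually_gt_atTop k] with m hm using hft k m hm
  have hnorm : Tendsto (fun n => ‖t n - (v - s)‖) atTop (𝓝 0) :=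
    tendsto_iff_norm_sub_tendsto_zero.1 htlim
  refine absurd (ge_of_tendsto' hnorm fun n => ?_) (not_le.2 hε)
  calc ε ≤ f n (z n) := hfz n
    _ ≤ f n (t n) := map_le_map_of_nonneg (hf0 n) (hzt n)
    _ ≤ f n (t n) - f n (v - s) := by linarith [hflim n]
    _ = f n (t n - (v - s)) := (map_sub _ _ _).symm
    _ ≤ ‖f n‖ * ‖t n - (v - s)‖ := (le_abs_self _).trans ((f n).le_opNorm _)
    _ ≤ 1 * ‖t n - (v - s)‖ := by gcongr; exact hf1 n
    _ = _ := one_mul _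

/-- `sup {2 t a - t² w | t = 0, 1 / N, …, 1}`, a lattice approximation of `a² / w`. -/
noncomputable def gridSquare (w : F) (N : ℕ) (a : F) : F :=
  (Finset.range (N + 1)).sup' Finset.nonempty_range_add_one fun j =>
    (2 * ((j : ℝ) / N)) • a - ((j : ℝ) / N) ^ 2 • w

/-- One step beyond either end of the grid is allowed, since for `0 ≤ a ≤ w` those values are
dominated by the end values. The shifts by `±1` in `gridSquare_midpoint` need this. -/
theorem le_gridSquare {w a : F} (ha : 0 ≤ a) (haw : a ≤ w) {N : ℕ} (hN : 0 < N) (j : ℤ)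
    (hj0 : -1 ≤ j) (hjN : j ≤ N + 1) :
    (2 * ((j : ℝ) / N)) • a - ((j : ℝ) / N) ^ 2 • w ≤ gridSquare w N a := by
  have hw : 0 ≤ w := ha.trans haw
  have hgrid : ∀ k : ℕ, k ≤ N →
      (2 * ((k : ℝ) / N)) • a - ((k : ℝ) / N) ^ 2 • w ≤ gridSquare w N a := fun k hk =>
    Finset.le_sup' (fun j : ℕ => (2 * ((j : ℝ) / N)) • a - ((j : ℝ) / N) ^ 2 • w)
      (Finset.mem_range.2 (by omega))
  have hN0 : (0 : ℝ) < N := by exact_mod_cast hN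
  rcases hj0.eq_or_lt with rfl | hj0
  · refine le_trans ?_ (hgrid 0 (Nat.zero_le _))
    rw [← sub_nonneg]
    have e : (2 * (((0 : ℕ) : ℝ) / N)) • a - (((0 : ℕ) : ℝ) / N) ^ 2 • w
        - ((2 * (((-1 : ℤ) : ℝ) / N)) • a - (((-1 : ℤ) : ℝ) / N) ^ 2 • w)
        = (2 * (1 / (N : ℝ))) • a + (1 / (N : ℝ)) ^ 2 • w := by
      push_cast
      module
    rw [e]
    exact add_nonneg (smul_nonneg (by positivity) ha) (smul_nonneg (by positivity) hw)
  rcases hjN.eq_or_lt with rfl | hjN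
  · refine le_trans ?_ (hgrid N le_rfl)
    rw [← sub_nonneg]
    have e : (2 * ((N : ℝ) / N)) • a - ((N : ℝ) / N) ^ 2 • w
        - ((2 * (((N + 1 : ℤ) : ℝ) / N)) • a - (((N + 1 : ℤ) : ℝ) / N) ^ 2 • w)
        = (2 * (1 / (N : ℝ))) • (w - a) + (1 / (N : ℝ)) ^ 2 • w := by
      push_cast
      rw [add_div, div_self hN0.ne']
      module
    rw [e]
    exact add_nonneg (smul_nonneg (by positivity) (sub_nonneg.2 haw))
      (smul_nonneg (by positivity) hw)
  · lift j to ℕ using (by omega)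
    exact hgrid j (by omega)

theorem gridSquare_le {w a : F} (ha : 0 ≤ a) (haw : a ≤ w) {N : ℕ} (hN : 0 < N) :
    gridSquare w N a ≤ (2 : ℝ) • w := by
  have hw : 0 ≤ w := ha.trans haw
  have hN0 : (0 : ℝ) < N := by exact_mod_cast hN
  refine Finset.sup'_le _ _ fun j hj => ?_
  have hj1 : (j : ℝ) / N ≤ 1 := by
    rw [div_le_one hN0]
    exact_mod_cast Nat.lt_succ_iff.1 (Finset.mem_range.1 hj)
  refine (sub_le_self _ (smul_nonneg (by positivity) hw)).trans ?_
  calc (2 * ((j : ℝ) / N)) • a ≤ (2 * ((j : ℝ) / N)) • w :=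
        smul_le_smul_of_nonneg_left haw (by positivity)
    _ ≤ (2 : ℝ) • w := smul_le_smul_of_nonneg_right (by linarith) hw

theorem gridSquare_nonneg {w a : F} (ha : 0 ≤ a) (haw : a ≤ w) {N : ℕ} (hN : 0 < N) :
    0 ≤ gridSquare w N a := by
  simpa using le_gridSquare ha haw hN 0 (by norm_num) (by omega)

/-- Quantitative convexity. With `L_t a = 2 t a - t² w` and `h = 1 / N`, the mean of `L_{t+h} a` and
`L_{t-h} b` equals `L_t ((a + b) / 2) + h (a - b) - h² w`. Exchanging `a` and `b` produces `|a -
b|`. -/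
theorem gridSquare_midpoint {w a b : F} (ha : 0 ≤ a) (haw : a ≤ w) (hb : 0 ≤ b) (hbw : b ≤ w)
    {N : ℕ} (hN : 0 < N) :
    gridSquare w N ((2 : ℝ)⁻¹ • (a + b)) + (N : ℝ)⁻¹ • |a - b| ≤
      (2 : ℝ)⁻¹ • (gridSquare w N a + gridSquare w N b) + ((N : ℝ)⁻¹ ^ 2) • w := by
  have hN0 : (0 : ℝ) < N := by exact_mod_cast hN
  have key : ∀ a b : F, 0 ≤ a → a ≤ w → 0 ≤ b → b ≤ w → ∀ j ∈ Finset.range (N + 1),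
      (2 * ((j : ℝ) / N)) • ((2 : ℝ)⁻¹ • (a + b)) - ((j : ℝ) / N) ^ 2 • w ≤
      (2 : ℝ)⁻¹ • (gridSquare w N a + gridSquare w N b) + ((N : ℝ)⁻¹ ^ 2) • w
        - (N : ℝ)⁻¹ • (a - b) := by
    intro a b ha haw hb hbw j hj
    have hjN := Finset.mem_range.1 hj
    have h1 := le_gridSquare ha haw hN (j + 1) (by omega) (by omega)
    have h2 := le_gridSquare hb hbw hN (j - 1) (by omega) (by omega)
    have h3 := smul_le_smul_of_nonneg_left (add_le_add h1 h2) (by norm_num : (0 : ℝ) ≤ 2⁻¹)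
    rw [← sub_nonneg] at h3 ⊢
    convert h3 using 1
    push_cast
    rw [add_div, sub_div, one_div]
    module
  rw [← le_sub_iff_add_le]
  refine Finset.sup'_le _ _ fun j hj => ?_
  have h1 := key a b ha haw hb hbw j hj
  have h2 := key b a hb hbw ha haw j hj
  rw [add_comm b a, add_comm (gridSquare w N b)] at h2
  rw [le_sub_comm] at h1 h2 ⊢
  have hinv : (0 : ℝ) ≤ (N : ℝ)⁻¹ := by positivity
  have hsup : ∀ c : F, (N : ℝ)⁻¹ • (a - b) ≤ c → (N : ℝ)⁻¹ • (b - a) ≤ c →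
      (N : ℝ)⁻¹ • |a - b| ≤ c := by
    intro c hc1 hc2
    have e : ∀ x : F, (N : ℝ)⁻¹ • x ≤ c → x ≤ (N : ℝ) • c := fun x hx => by
      have := smul_le_smul_of_nonneg_left hx hN0.le
      rwa [smul_inv_smul₀ hN0.ne'] at this
    have h : |a - b| ≤ (N : ℝ) • c := sup_le (e _ hc1) (by rw [neg_sub]; exact e _ hc2)
    have := smul_le_smul_of_nonneg_left h hinv
    rwa [inv_smul_smul₀ hN0.ne'] at this
  exact hsup _ h1 h2

theorem abs_sub_le_of_mem_Icc {w a b : F} (ha : 0 ≤ a) (haw : a ≤ w) (hb : 0 ≤ b) (hbw : b ≤ w) :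
    |a - b| ≤ w :=
  sup_le ((sub_le_self _ hb).trans haw) (by rw [neg_sub]; exact (sub_le_self _ ha).trans hbw)

/-- A directed family of convex subsets of an interval without nontrivial disjoint sequences has
norm approximate cluster points. -/
theorem IntervalDisjointNull.exists_approx_cluster [CompleteSpace F] {w : F}
    (hw : IntervalDisjointNull w) (hw0 : 0 ≤ w) {ι : Type*} [Nonempty ι] {U : ι → Set F}
    (hUdir : Directed (· ⊇ ·) U) (hUconv : ∀ i, Convex ℝ (U i)) (hUne : ∀ i, (U i).Nonempty)
    (hUw : ∀ i, U i ⊆ Set.Icc 0 w) {ε : ℝ} (hε : 0 < ε) :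
    ∃ c : F, ∀ i, ∃ c' ∈ U i, ‖c - c'‖ ≤ ε := by
  obtain ⟨φ, hφ, δ, hδ, hφδ⟩ := hw.exists_dominating_functional hε
  have hφw : 0 ≤ φ w := hφ w hw0
  -- Midpoint convexity will give `φ |c - c'| ≤ (2 + φ w) / N`, which has to be below `δ`.
  obtain ⟨N, hN⟩ := exists_nat_gt ((2 + φ w) / δ)
  have hN0 : (0 : ℝ) < N := lt_of_le_of_lt (by positivity) hN
  have hNpos : 0 < N := by exact_mod_cast hN0
  set η : ℝ := (N : ℝ)⁻¹ with hη
  have hη0 : 0 < η := inv_pos.2 hN0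
  let Φ : F → ℝ := fun a => φ (gridSquare w N a)
  have hΦle : ∀ a ∈ Set.Icc 0 w, Φ a ≤ 2 * φ w := fun a ha => by
    have := map_le_map_of_nonneg hφ (gridSquare_le ha.1 ha.2 hNpos)
    rwa [map_smul, smul_eq_mul] at this
  have hΦ0 : ∀ a ∈ Set.Icc 0 w, 0 ≤ Φ a := fun a ha => hφ _ (gridSquare_nonneg ha.1 ha.2 hNpos)
  -- The supremum of `S` is `sup_i inf_{U i} Φ`. Near-minimisers in sets below `U i₀` have their
  -- midpoint in `U i₀`, where `Φ` cannot drop much lower; so they are close, and `c` depends on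
  -- `i₀` alone.
  let S : Set ℝ := {r | ∃ i, ∀ z ∈ U i, r ≤ Φ z}
  have hSne : S.Nonempty := ⟨0, Classical.arbitrary ι, fun z hz => hΦ0 z (hUw _ hz)⟩
  have hSbdd : BddAbove S := by
    refine ⟨2 * φ w, ?_⟩
    rintro r ⟨i, hi⟩
    obtain ⟨z, hz⟩ := hUne i
    exact (hi z hz).trans (hΦle z (hUw i hz))
  have hη2 : 0 < η ^ 2 := by positivity
  obtain ⟨r, ⟨i₀, hi₀⟩, hr⟩ := exists_lt_of_lt_csSup hSne (sub_lt_self (sSup S) hη2)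
  have hlow : ∀ i, ∃ z ∈ U i, Φ z < sSup S + η ^ 2 := by
    intro i
    by_contra! h
    have := le_csSup hSbdd (show sSup S + η ^ 2 ∈ S from ⟨i, h⟩)
    linarith
  obtain ⟨c, hc, hcΦ⟩ := hlow i₀
  refine ⟨c, fun i => ?_⟩
  obtain ⟨j, hj₀, hji⟩ := hUdir i₀ i
  obtain ⟨c', hc', hcΦ'⟩ := hlow j
  have hcw := hUw _ hc
  have hcw' := hUw _ hc'
  have hmid : (2 : ℝ)⁻¹ • (c + c') ∈ U i₀ := by
    rw [smul_add]
    exact hUconv i₀ hc (hj₀ hc') (by norm_num) (by norm_num) (by norm_num)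
  have h1 := map_le_map_of_nonneg hφ (gridSquare_midpoint hcw.1 hcw.2 hcw'.1 hcw'.2 hNpos)
  simp only [map_add, map_smul, smul_eq_mul] at h1
  have h2 : r ≤ φ (gridSquare w N ((2 : ℝ)⁻¹ • (c + c'))) := hi₀ _ hmid
  have h3 : η * φ |c - c'| ≤ η * (η * (2 + φ w)) := by
    change φ (gridSquare w N c) < _ at hcΦ
    change φ (gridSquare w N c') < _ at hcΦ'
    linarith
  have h4 : φ |c - c'| ≤ η * (2 + φ w) := le_of_mul_le_mul_left h3 hη0
  have h5 : η * (2 + φ w) < δ := by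
    rw [hη, inv_mul_lt_iff₀ hN0]
    rwa [div_lt_iff₀ hδ] at hN
  refine ⟨c', hji hc', ?_⟩
  rw [← norm_abs_eq_norm]
  exact (hφδ _ (abs_nonneg _) (abs_sub_le_of_mem_Icc hcw.1 hcw.2 hcw'.1 hcw'.2)
    (h4.trans_lt h5)).le

end PositiveFunctionals

/-! ### Disjoint sequences when the dual is a KB-space -/

section DisjointWeaklyNull

variable {E : Type*} [NormedAddCommGroup E] [NormedSpace ℝ E] [Lattice E] [IsOrderedAddMonoid E]
  [HasSolidNorm E]

/-- A bounded nonnegative additive function on the positive cone extends to the whole space. -/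
theorem exists_dual_eq_on_cone {p : E → ℝ} {C : ℝ} (h0 : ∀ x, 0 ≤ x → 0 ≤ p x)
    (hC : ∀ x, 0 ≤ x → p x ≤ C * ‖x‖) (hC0 : 0 ≤ C)
    (hadd : ∀ x y, 0 ≤ x → 0 ≤ y → p (x + y) = p x + p y) :
    ∃ g : StrongDual ℝ E, ∀ x, 0 ≤ x → g x = p x := by
  have hp := fun z : E => posPart_nonneg z
  have hn := fun z : E => negPart_nonneg z
  let H : E →+ ℝ := AddMonoidHom.mk' (fun x => p x⁺ - p x⁻) (by
    intro x y
    have h : (x + y)⁺ + (x⁻ + y⁻) = (x + y)⁻ + (x⁺ + y⁺) := by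
      have e1 := posPart_sub_negPart (x + y)
      have e2 := posPart_sub_negPart x
      have e3 := posPart_sub_negPart y
      have e4 : (x + y)⁺ - (x + y)⁻ = (x⁺ - x⁻) + (y⁺ - y⁻) := by rw [e1, e2, e3]
      have e5 : (x + y)⁺ + (x⁻ + y⁻) - ((x + y)⁻ + (x⁺ + y⁺))
          = ((x + y)⁺ - (x + y)⁻) - ((x⁺ - x⁻) + (y⁺ - y⁻)) := by abel
      rw [← sub_eq_zero, e5, e4, sub_self]
    have h' := congrArg p h
    rw [hadd _ _ (hp _) (add_nonneg (hn _) (hn _)), hadd _ _ (hn _) (hn _),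
      hadd _ _ (hn _) (add_nonneg (hp _) (hp _)), hadd _ _ (hp _) (hp _)] at h'
    linarith)
  have hbound : ∀ x, ‖H x‖ ≤ C * ‖x‖ := by
    intro x
    have hpx : ‖x⁺‖ ≤ ‖x‖ := norm_le_norm_of_abs_le_abs (by
      rw [abs_of_nonneg (hp x), ← posPart_add_negPart x]
      exact le_add_of_nonneg_right (hn x))
    have hnx : ‖x⁻‖ ≤ ‖x‖ := norm_le_norm_of_abs_le_abs (by
      rw [abs_of_nonneg (hn x), ← posPart_add_negPart x]
      exact le_add_of_nonneg_left (hp x))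
    have h1 := h0 _ (hp x)
    have h2 := h0 _ (hn x)
    have h3 := (hC _ (hp x)).trans (mul_le_mul_of_nonneg_left hpx hC0)
    have h4 := (hC _ (hn x)).trans (mul_le_mul_of_nonneg_left hnx hC0)
    change |p x⁺ - p x⁻| ≤ _
    rw [abs_le]
    constructor <;> linarith
  refine ⟨H.toRealLinearMap (AddMonoidHomClass.continuous_of_bound H C hbound), fun x hx => ?_⟩
  change p x⁺ - p x⁻ = p x
  have hz := hadd 0 0 le_rfl le_rfl
  rw [add_zero] at hz
  rw [posPart_of_nonneg hx, negPart_of_nonneg hx]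
  linarith

/-- `sup_k f (x ⊓ k w)`, the value at `x ≥ 0` of the component of `f ≥ 0` carried by `w`. -/
noncomputable def carriedPart (f : StrongDual ℝ E) (w x : E) : ℝ := ⨆ k : ℕ, f (x ⊓ k • w)

variable [IsOrderedModule ℝ E]

section

variable {f : StrongDual ℝ E} (hf : 0 ≤ f)
include hf

theorem le_carriedPart (w x : E) (k : ℕ) : f (x ⊓ k • w) ≤ carriedPart f w x :=
  le_ciSup (f := fun k : ℕ => f (x ⊓ k • w))
    ⟨f x, by rintro _ ⟨k, rfl⟩; exact map_le_map_of_nonneg hf inf_le_left⟩ k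

theorem carriedPart_le_apply (w x : E) : carriedPart f w x ≤ f x :=
  ciSup_le fun _ => map_le_map_of_nonneg hf inf_le_left

theorem carriedPart_nonneg {w x : E} (hx : 0 ≤ x) : 0 ≤ carriedPart f w x := by
  have := le_carriedPart hf w x 0
  rwa [zero_nsmul, inf_eq_right.2 hx, map_zero] at this

theorem carriedPart_mono {w w' : E} (h : w ≤ w') (x : E) :
    carriedPart f w x ≤ carriedPart f w' x :=
  ciSup_le fun k => (map_le_map_of_nonneg hf
    (inf_le_inf_left x (nsmul_le_nsmul_right h k))).trans (le_carriedPart hf w' x k)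

/-- Superadditivity uses `x ⊓ l w + y ⊓ k w ≤ (x + y) ⊓ (l + k) w`, which is why the supremum runs
over all multiples of `w`. -/
theorem carriedPart_add {w x y : E} (hw : 0 ≤ w) (hx : 0 ≤ x) (hy : 0 ≤ y) :
    carriedPart f w (x + y) = carriedPart f w x + carriedPart f w y := by
  apply le_antisymm
  · refine ciSup_le fun k => ?_
    have h : (x + y) ⊓ k • w ≤ x ⊓ k • w + y ⊓ k • w := by
      have := inf_add_le_inf_add_inf (nsmul_nonneg hw k) hx hy
      rwa [inf_comm, inf_comm (k • w), inf_comm (k • w)] at this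
    refine (map_le_map_of_nonneg hf h).trans ?_
    rw [map_add]
    exact add_le_add (le_carriedPart hf w x k) (le_carriedPart hf w y k)
  · rw [← le_sub_iff_add_le]
    refine ciSup_le fun k => ?_
    rw [le_sub_comm]
    refine ciSup_le fun l => ?_
    rw [le_sub_iff_add_le, ← map_add]
    refine (map_le_map_of_nonneg hf ?_).trans (le_carriedPart hf w (x + y) (l + k))
    refine le_inf ?_ ?_
    · rw [add_comm x y]
      exact add_le_add inf_le_left inf_le_left
    · rw [add_nsmul]
      exact add_le_add inf_le_right inf_le_right

end

theorem inf_sum_eq_zero {ι : Type*} {a : E} (ha : 0 ≤ a) {b : ι → E} (hb : ∀ i, 0 ≤ b i)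
    {s : Finset ι} (h : ∀ i ∈ s, a ⊓ b i = 0) : a ⊓ ∑ i ∈ s, b i = 0 := by
  rw [← norm_le_zero_iff]
  refine (norm_inf_sum_le ha hb s).trans (Finset.sum_nonpos fun i hi => ?_)
  rw [h i hi, norm_zero]

/-- If the dual is a KB-space, positive functionals vanish along bounded disjoint sequences. -/
theorem IsKBSpace.tendsto_apply_of_nonneg (hKB : IsKBSpace (StrongDual ℝ E)) {v : ℕ → E}
    (hv : ∀ n, 0 ≤ v n) (hdisj : DisjointSeq v) {C : ℝ} (hC : ∀ n, ‖v n‖ ≤ C)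
    {f : StrongDual ℝ E} (hf : 0 ≤ f) : Tendsto (fun n => f (v n)) atTop (𝓝 0) := by
  let s : ℕ → E := fun n => ∑ i ∈ Finset.range n, v i
  have hs0 : ∀ n, 0 ≤ s n := fun n => Finset.sum_nonneg fun i _ => hv i
  have hsucc : ∀ n, s (n + 1) = s n + v n := fun n => Finset.sum_range_succ _ _
  have hbound : ∀ n x, 0 ≤ x → carriedPart f (s n) x ≤ ‖f‖ * ‖x‖ := fun n x _ =>
    (carriedPart_le_apply hf (s n) x).trans ((le_abs_self _).trans (f.le_opNorm x))
  choose g hg using fun n => exists_dual_eq_on_cone (p := carriedPart f (s n))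
    (fun x hx => carriedPart_nonneg hf hx) (hbound n) (norm_nonneg f)
    (fun x y hx hy => carriedPart_add hf (hs0 n) hx hy)
  have hg0 : ∀ n, 0 ≤ g n := fun n x hx => by
    rw [hg n x hx]
    exact carriedPart_nonneg hf hx
  have hmono : Monotone g := monotone_nat_of_le_succ fun n x hx => by
    rw [hg n x hx, hg (n + 1) x hx]
    refine carriedPart_mono hf ?_ x
    rw [hsucc]
    exact le_add_of_nonneg_right (hv n)
  have hgnorm : ∀ n, ‖g n‖ ≤ ‖f‖ := fun n =>
    ContinuousLinearMap.opNorm_le_bound _ (norm_nonneg f) fun x => by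
      have h1 : |g n x| ≤ g n |x| := by
        rw [abs_le]
        constructor
        · have := map_le_map_of_nonneg (hg0 n) (neg_le.1 (neg_le_abs x))
          rwa [map_neg] at this
        · exact map_le_map_of_nonneg (hg0 n) (le_abs_self x)
      refine h1.trans ?_
      rw [hg n _ (abs_nonneg x), ← norm_abs_eq_norm x]
      exact hbound n _ (abs_nonneg x)
  obtain ⟨h, hh⟩ := hKB g hg0 hmono (by
    refine (Metric.isBounded_closedBall (x := (0 : StrongDual ℝ E)) (r := ‖f‖)).subset ?_
    rintro _ ⟨n, rfl⟩
    simpa using hgnorm n)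
  -- The component of `f` carried by `s (n + 1)` recovers `f` at `v n`, while the one carried by `s
  -- n` vanishes there by disjointness. Hence `f (v n)` is bounded by consecutive differences of a
  -- convergent sequence.
  have hdiff : Tendsto (fun n => ‖g (n + 1) - g n‖ * C) atTop (𝓝 0) := by
    simpa using ((hh.comp (tendsto_add_atTop_nat 1)).sub hh).norm.mul_const C
  refine squeeze_zero (fun n => hf _ (hv n)) (fun n => ?_) hdiff
  have h1 : f (v n) ≤ g (n + 1) (v n) := by
    rw [hg _ _ (hv n)]
    have := le_carriedPart hf (s (n + 1)) (v n) 1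
    rwa [one_nsmul, hsucc, inf_eq_left.2 (le_add_of_nonneg_left (hs0 n)), ← hsucc] at this
  have h2 : g n (v n) ≤ 0 := by
    rw [hg _ _ (hv n)]
    refine ciSup_le fun k => ?_
    have hd : v n ⊓ s n = 0 := inf_sum_eq_zero (hv n) hv fun i hi => by
      have : |v n| ⊓ |v i| = 0 := hdisj (Finset.mem_range.1 hi).ne'
      rwa [abs_of_nonneg (hv n), abs_of_nonneg (hv i)] at this
    have hk : v n ⊓ k • s n = 0 := by
      have := inf_sum_eq_zero (hv n) (b := fun _ : ℕ => s n) (fun _ => hs0 n)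
        (s := Finset.range k) fun _ _ => hd
      simpa using this
    rw [hk, map_zero]
  calc f (v n) ≤ g (n + 1) (v n) - g n (v n) := by linarith
    _ = (g (n + 1) - g n) (v n) := rfl
    _ ≤ ‖g (n + 1) - g n‖ * ‖v n‖ := (le_abs_self _).trans ((g (n + 1) - g n).le_opNorm (v n))
    _ ≤ ‖g (n + 1) - g n‖ * C := by gcongr; exact hC n

theorem IsKBSpace.tendsto_apply (hKB : IsKBSpace (StrongDual ℝ E)) {v : ℕ → E}
    (hv : ∀ n, 0 ≤ v n) (hdisj : DisjointSeq v) {C : ℝ} (hC : ∀ n, ‖v n‖ ≤ C)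
    (f : StrongDual ℝ E) : Tendsto (fun n => f (v n)) atTop (𝓝 0) := by
  have h1 := hKB.tendsto_apply_of_nonneg hv hdisj hC (dualPosPart_nonneg f)
  have h2 := hKB.tendsto_apply_of_nonneg hv hdisj hC (sub_nonneg.2 (le_dualPosPart f))
  simpa using h1.sub h2

end DisjointWeaklyNull

/-! ### Weakly null sequences and limited sets -/

section Limited

variable {X : Type*} [NormedAddCommGroup X] [NormedSpace ℝ X]

theorem weaklyNull_iff {x : ℕ → X} :
    WeaklyNull x ↔ ∀ f : StrongDual ℝ X, Tendsto (fun n => f (x n)) atTop (𝓝 0) := by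
  unfold WeaklyNull
  rw [(NormedSpace.isEmbedding_inclusionInDoubleDualWeak ℝ X).tendsto_nhds_iff, map_zero]
  exact tendsto_iff_forall_eval_tendsto_topDualPairing

theorem weakStarNull_iff {f : ℕ → StrongDual ℝ X} :
    WeakStarNull f ↔ ∀ x : X, Tendsto (fun n => f n x) atTop (𝓝 0) :=
  tendsto_iff_forall_eval_tendsto_topDualPairing

theorem isLimitedSet_singleton (x : X) : IsLimitedSet {x} := by
  refine ⟨Bornology.isBounded_singleton, fun f hf => ?_⟩
  rw [Metric.tendstoUniformlyOn_iff]
  intro ε hε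
  filter_upwards [(weakStarNull_iff.1 hf x).eventually (Metric.ball_mem_nhds 0 hε)] with n hn y hy
  rw [Set.mem_singleton_iff.1 hy, dist_comm]
  exact hn

/-- In a space with the weak* Dunford-Pettis property weakly null sequences are limited. -/
theorem WeakStarDunfordPettis.isLimitedSet_range (hDP : WeakStarDunfordPettis X) {x : ℕ → X}
    (hx : WeaklyNull x) {C : ℝ} (hC : ∀ n, ‖x n‖ ≤ C) : IsLimitedSet (Set.range x) := by
  refine ⟨(Metric.isBounded_closedBall (x := (0 : X)) (r := C)).subset (by
    rintro _ ⟨n, rfl⟩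
    simpa using hC n), fun f hf => ?_⟩
  rw [Metric.tendstoUniformlyOn_iff]
  intro ε hε
  by_contra hnot
  simp only [Set.forall_mem_range, dist_zero_left] at hnot
  obtain ⟨φ, hφ, hφ'⟩ := extraction_of_frequently_atTop (not_eventually.1 hnot)
  push Not at hφ'
  choose k hk using hφ'
  have hf' := weakStarNull_iff.1 hf
  -- Each fixed `x i` is eventually excluded because `f (φ n) (x i) → 0`. Divergence of `k`, without
  -- monotonicity, suffices for `x (k n)` to be weakly null.
  have hk_top : Tendsto k atTop atTop := by
    refine tendsto_atTop.2 fun b => ?_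
    have hev : ∀ᶠ n in atTop, ∀ i ∈ Finset.range b, ‖f (φ n) (x i)‖ < ε := by
      rw [Finset.eventually_all]
      intro i _
      have := ((hf' (x i)).comp hφ.tendsto_atTop).norm
      rw [norm_zero] at this
      exact this.eventually_lt_const hε
    filter_upwards [hev] with n hn
    by_contra hlt
    exact absurd (hn (k n) (Finset.mem_range.2 (not_le.1 hlt))) (not_lt.2 (hk n))
  have hlim := hDP (fun n => x (k n)) (fun n => f (φ n)) (hx.comp hk_top)
    (hf.comp hφ.tendsto_atTop)
  have := hlim.norm
  rw [norm_zero] at this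
  exact absurd (ge_of_tendsto' this hk) (not_le.2 hε)

end Limited

/-! ### Positive limitedly L-weakly compact operators -/

theorem IsLwcSet.intervalDisjointNull {F : Type*} [NormedAddCommGroup F] [Lattice F]
    [IsOrderedAddMonoid F] {A : Set F} (hA : IsLwcSet A) {a : F} (ha : a ∈ A) (h0 : 0 ≤ a) :
    IntervalDisjointNull a := fun y hy0 hya hy =>
  hA.2 y (fun n => Set.mem_biUnion ha
    ⟨(neg_nonpos.2 (abs_nonneg a)).trans (hy0 n), by rw [abs_of_nonneg h0]; exact hya n⟩) hy

variable {E : Type*} [NormedAddCommGroup E] [NormedSpace ℝ E] [Lattice E] [IsOrderedAddMonoid E]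
  [IsOrderedModule ℝ E] [HasSolidNorm E] [CompleteSpace E]
  {F : Type*} [NormedAddCommGroup F] [NormedSpace ℝ F] [Lattice F] [IsOrderedAddMonoid F]
  [IsOrderedModule ℝ F] [HasSolidNorm F] [CompleteSpace F]

/-- A positive limitedly L-weakly compact operator is M-weakly compact. -/
theorem IsLimitedlyLwc.tendsto_zero_of_disjointSeq (hKB : IsKBSpace (StrongDual ℝ E))
    (hDP : WeakStarDunfordPettis E) {T : E →L[ℝ] F} (hpos : ∀ x : E, 0 ≤ x → 0 ≤ T x)
    (hT : IsLimitedlyLwc T) {v : ℕ → E} (hv : ∀ n, 0 ≤ v n) (hdisj : DisjointSeq v) {C : ℝ}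
    (hC : ∀ n, ‖v n‖ ≤ C) : Tendsto (fun n => T (v n)) atTop (𝓝 0) := by
  have hnull := hKB.tendsto_apply hv hdisj hC
  have hLwc := hT _ (hDP.isLimitedSet_range (weaklyNull_iff.2 hnull) hC)
  have hmem : ∀ n, T (v n) ∈ T '' Set.range v := fun n => ⟨_, ⟨n, rfl⟩, rfl⟩
  have hTv : ∀ n, 0 ≤ T (v n) := fun n => hpos _ (hv n)
  refine tendsto_zero_of_norm_inf_tendsto hTv (C := ‖T‖ * C)
    (fun n => (T.le_opNorm _).trans (by gcongr; exact hC n)) (fun i => ?_)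
    fun φ y hy0 hy hdy => hLwc.2 y (fun n => Set.mem_biUnion (hmem (φ n))
      ⟨(neg_nonpos.2 (abs_nonneg _)).trans (hy0 n), (hy n).trans (le_abs_self _)⟩) hdy
  rw [Metric.tendsto_atTop]
  intro ε hε
  -- The meets lie in `[0, T (v i)]`, where the norm is controlled by a functional `g`, and `g (T (v
  -- n)) → 0` by weak nullity.
  obtain ⟨g, hg, δ, hδ, h⟩ :=
    (hLwc.intervalDisjointNull (hmem i) (hTv i)).exists_dominating_functional hε
  obtain ⟨N, hN⟩ := eventually_atTop.1 ((hnull (g.comp T)).eventually_lt_const hδ)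
  refine ⟨N, fun n hn => ?_⟩
  rw [dist_zero_right, norm_norm]
  exact h _ (le_inf (hTv n) (hTv i)) inf_le_right
    ((map_le_map_of_nonneg hg inf_le_left).trans_lt (hN n hn))

/-- M-weakly compact operators are small outside an order interval, uniformly on the ball. -/
theorem exists_norm_map_posPart_sub_le {T : E →L[ℝ] F}
    (hT : ∀ v : ℕ → E, (∀ n, 0 ≤ v n) → DisjointSeq v → (∀ n, ‖v n‖ ≤ 1) →
      Tendsto (fun n => T (v n)) atTop (𝓝 0)) {ε : ℝ} (hε : 0 < ε) :
    ∃ u : E, 0 ≤ u ∧ ∀ x, 0 ≤ x → ‖x‖ ≤ 1 → ‖T (x - u)⁺‖ ≤ ε := by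
  by_contra! hnot
  -- The failing candidate for `u` is the vector subtracted in `disjointify`. The absolute value
  -- only secures positivity for arbitrary lists and disappears for the chosen sequence.
  let R : List E → E → Prop := fun l y =>
    0 ≤ y ∧ ‖y‖ ≤ 1 ∧ ε < ‖T (y - |(4 ^ l.length : ℝ) • l.sum|)⁺‖
  obtain ⟨x, hx⟩ := exists_seq_of_list_history (R := R) fun l => hnot _ (abs_nonneg _)
  have hx0 : ∀ n, 0 ≤ x n := fun n => (hx n).1
  have hx1 : ∀ n, ‖x n‖ ≤ 1 := fun n => (hx n).2.1
  have hxε : ∀ n, ε < ‖T (x n - (4 ^ n : ℝ) • ∑ i ∈ Finset.range n, x i)⁺‖ := fun n => by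
    have h := (hx n).2.2
    have e : ((List.range n).map x).sum = ∑ i ∈ Finset.range n, x i := rfl
    rw [e, List.length_map, List.length_range, abs_of_nonneg (smul_nonneg (by positivity)
      (Finset.sum_nonneg fun i _ => hx0 i))] at h
    exact h
  obtain ⟨v, hv, hxv⟩ := exists_majorant hx0 hx1
  have ht := hT (disjointify v x) (disjointify_nonneg v x) (disjointSeq_disjointify hv hx0 hxv)
    fun n => (norm_le_norm_of_nonneg_of_le (disjointify_nonneg v x n)
      (disjointify_le hv hx0 n)).trans (hx1 n)
  have hlim : Tendsto (fun n => ‖T (disjointify v x n)‖ + ‖T‖ * ((2 : ℝ)⁻¹ ^ n * ‖v‖))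
      atTop (𝓝 0) := by
    have h2 : Tendsto (fun n : ℕ => (2 : ℝ)⁻¹ ^ n) atTop (𝓝 0) :=
      tendsto_pow_atTop_nhds_zero_of_lt_one (by norm_num) (by norm_num)
    simpa using ht.norm.add ((h2.mul_const ‖v‖).const_mul ‖T‖)
  refine absurd (ge_of_tendsto' hlim fun n => (hxε n).le.trans ?_) (not_le.2 hε)
  set z := x n - (4 ^ n : ℝ) • ∑ i ∈ Finset.range n, x i
  have hc : 0 ≤ ((2 : ℝ)⁻¹ ^ n) • v := smul_nonneg (by positivity) hv
  have hd : disjointify v x n = (z - ((2 : ℝ)⁻¹ ^ n) • v)⁺ := rfl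
  have h1 : 0 ≤ z⁺ - disjointify v x n := by
    rw [hd, sub_nonneg]
    exact posPart_mono (sub_le_self _ hc)
  have h2 : z⁺ - disjointify v x n ≤ ((2 : ℝ)⁻¹ ^ n) • v := by
    rw [hd, sub_le_iff_le_add']
    refine sup_le ?_ (add_nonneg (posPart_nonneg _) hc)
    rw [← sub_le_iff_le_add]
    exact le_posPart _
  have h3 : ‖z⁺ - disjointify v x n‖ ≤ (2 : ℝ)⁻¹ ^ n * ‖v‖ := by
    refine (norm_le_norm_of_nonneg_of_le h1 h2).trans ?_
    rw [norm_smul, Real.norm_of_nonneg (by positivity)]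
  calc ‖T z⁺‖ = ‖T (disjointify v x n) + T (z⁺ - disjointify v x n)‖ := by
        rw [← map_add, add_sub_cancel]
    _ ≤ ‖T (disjointify v x n)‖ + ‖T (z⁺ - disjointify v x n)‖ := norm_add_le _ _
    _ ≤ _ := by
        gcongr
        exact (T.le_opNorm _).trans (by gcongr)

/-- A positive operator that is small outside an order interval maps the ball into a small
perturbation of an order interval. -/
theorem exists_mem_Icc_norm_map_sub_le {T : E →L[ℝ] F} (hpos : ∀ x : E, 0 ≤ x → 0 ≤ T x)
    {u : E} (hu : 0 ≤ u) {ε : ℝ} (hT : ∀ x, 0 ≤ x → ‖x‖ ≤ 1 → ‖T (x - u)⁺‖ ≤ ε) {x : E}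
    (hx : ‖x‖ ≤ 1) :
    ∃ z ∈ Set.Icc 0 (T u + T u), ∃ e : F, ‖e‖ ≤ 2 * ε ∧ T x = z - T u + e := by
  have hmono : ∀ {a b : E}, a ≤ b → T a ≤ T b := fun {a b} h => by
    have := hpos _ (sub_nonneg.2 h)
    rwa [map_sub, sub_nonneg] at this
  have hp := posPart_nonneg x
  have hn := negPart_nonneg x
  have hp1 : ‖x⁺‖ ≤ 1 := by
    rw [← norm_abs_eq_norm] at hx
    exact (norm_le_norm_of_nonneg_of_le hp (by
      rw [← posPart_add_negPart x]; exact le_add_of_nonneg_right hn)).trans hx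
  have hn1 : ‖x⁻‖ ≤ 1 := by
    rw [← norm_abs_eq_norm] at hx
    exact (norm_le_norm_of_nonneg_of_le hn (by
      rw [← posPart_add_negPart x]; exact le_add_of_nonneg_left hp)).trans hx
  have hsplit : ∀ y : E, y = y ⊓ u + (y - u)⁺ := fun y => by
    have : (y - u)⁺ = y - y ⊓ u := by
      rw [sub_inf, sub_self, sup_comm]
      rfl
    rw [this, add_sub_cancel]
  -- Both parts of `x` are cut at `u`; adding `T u` moves the main term from `[-T u, T u]` into `[0,
  -- 2 T u]`.
  refine ⟨T (x⁺ ⊓ u) - T (x⁻ ⊓ u) + T u, ⟨?_, ?_⟩, T (x⁺ - u)⁺ - T (x⁻ - u)⁺, ?_, ?_⟩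
  · have h1 : T (x⁻ ⊓ u) ≤ T u := hmono inf_le_right
    have h2 : 0 ≤ T (x⁺ ⊓ u) := hpos _ (le_inf hp hu)
    rw [sub_add_eq_add_sub, sub_nonneg]
    exact h1.trans (le_add_of_nonneg_left h2)
  · gcongr
    exact (sub_le_self _ (hpos _ (le_inf hn hu))).trans (hmono inf_le_right)
  · calc ‖T (x⁺ - u)⁺ - T (x⁻ - u)⁺‖ ≤ ‖T (x⁺ - u)⁺‖ + ‖T (x⁻ - u)⁺‖ := norm_sub_le _ _
      _ ≤ 2 * ε := by linarith [hT _ hp hp1, hT _ hn hn1]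
  · conv_lhs => rw [← posPart_sub_negPart x, hsplit x⁺, hsplit x⁻]
    simp only [map_sub, map_add]
    abel

end BanachLattice

/-! ### Weak compactness through the bidual -/

open BanachLattice in
theorem mainTheorem8
    {E : Type*} [NormedAddCommGroup E] [NormedSpace ℝ E] [Lattice E] [IsOrderedAddMonoid E]
    [IsOrderedModule ℝ E] [HasSolidNorm E] [CompleteSpace E]
    {F : Type*} [NormedAddCommGroup F] [NormedSpace ℝ F] [Lattice F] [IsOrderedAddMonoid F]
    [IsOrderedModule ℝ F] [HasSolidNorm F] [CompleteSpace F]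
    (hKB : BanachLattice.IsKBSpace (StrongDual ℝ E))
    (hDP : BanachLattice.WeakStarDunfordPettis E)
    (hd : BanachLattice.PropertyD F)
    (T : E →L[ℝ] F) (hpos : ∀ x : E, 0 ≤ x → 0 ≤ T x)
    (hT : BanachLattice.IsLimitedlyLwc T) :
    BanachLattice.IsWeaklyCompactOperator T := by
  refine NormedSpace.isCompact_closure_of_isBounded ℝ F _ ?_ fun ξ hξ => ?_
  · rw [Set.preimage_image_eq _ (toWeakSpace ℝ F).injective]
    exact T.lipschitz.isBounded_image Metric.isBounded_closedBall
  set ξ' : StrongDual ℝ (StrongDual ℝ F) := WeakDual.toStrongDual ξ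
  -- The canonical image of `F` is complete, hence closed in `F**`, so it suffices to approximate
  -- `ξ` in norm.
  suffices h : ∀ ε > 0, ∃ c : F, ‖ξ' - NormedSpace.inclusionInDoubleDualLi ℝ c‖ < ε by
    have hclosed := (NormedSpace.inclusionInDoubleDualLi ℝ
      (E := F)).isometry.isUniformInducing.isComplete_range.isClosed
    have hmem := (SeminormedAddCommGroup.mem_closure_iff (a := ξ')
      (s := Set.range (NormedSpace.inclusionInDoubleDualLi ℝ (E := F)))).2 fun ε hε => by
        obtain ⟨c, hc⟩ := h ε hε
        exact ⟨_, ⟨c, rfl⟩, hc⟩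
    obtain ⟨y, hy⟩ := hclosed.closure_subset hmem
    exact ⟨toWeakSpace ℝ F y, hy⟩
  intro ε' hε'
  obtain ⟨ε, hε, hεε'⟩ : ∃ ε > 0, 3 * ε < ε' := ⟨ε' / 4, by linarith, by linarith⟩
  obtain ⟨u, hu, hTu⟩ := exists_norm_map_posPart_sub_le
    (fun v hv hdv hv1 => hT.tendsto_zero_of_disjointSeq hKB hDP hpos hv hdv hv1) hε
  have hw0 : 0 ≤ T u + T u := add_nonneg (hpos u hu) (hpos u hu)
  have hw : IntervalDisjointNull (T u + T u) :=
    (hT _ (isLimitedSet_singleton (u + u))).intervalDisjointNull (by simp) hw0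
  -- The points `z` for which `z - T u`, up to an error of norm `2ε`, agrees with `ξ` on finitely
  -- many functionals within `1 / (n + 1)`. Letting `e` vary with `z` keeps these sets convex.
  let U : Finset (StrongDual ℝ F) × ℕ → Set F := fun p =>
    {z | z ∈ Set.Icc 0 (T u + T u) ∧ ∃ e : F, ‖e‖ ≤ 2 * ε ∧
      ∀ f ∈ p.1, |f (z - T u + e) - ξ f| ≤ 1 / ((p.2 : ℝ) + 1)}
  have hUdir : Directed (· ⊇ ·) U := by
    classical
    have hanti : Antitone U := by
      rintro ⟨s, m⟩ ⟨t, n⟩ ⟨hst, hmn⟩ z ⟨hz, e, he, h⟩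
      refine ⟨hz, e, he, fun f hf => (h f (hst hf)).trans ?_⟩
      exact one_div_le_one_div_of_le (by positivity) (by simpa using hmn)
    exact directed_of_isDirected_le hanti
  have hUconv : ∀ p, Convex ℝ (U p) := by
    rintro ⟨s, n⟩ a ⟨ha, e, he, hae⟩ b ⟨hb, e', he', hbe⟩ α β hα hβ hαβ
    refine ⟨convex_Icc _ _ ha hb hα hβ hαβ, α • e + β • e', ?_, fun f hf => ?_⟩
    · have := convex_closedBall (0 : F) (2 * ε) (x := e) (by simpa using he) (y := e')
        (by simpa using he') hα hβ hαβ
      simpa using this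
    · have h1 := hae f hf
      have h2 := hbe f hf
      have e1 : f (α • a + β • b - T u + (α • e + β • e')) - ξ f
          = α * (f (a - T u + e) - ξ f) + β * (f (b - T u + e') - ξ f) := by
        simp only [map_add, map_sub, map_smul, smul_eq_mul]
        linear_combination (f (T u) + ξ f) * hαβ
      rw [e1]
      refine (abs_add_le _ _).trans ?_
      rw [abs_mul, abs_mul, abs_of_nonneg hα, abs_of_nonneg hβ]
      calc _ ≤ α * (1 / ((n : ℝ) + 1)) + β * (1 / ((n : ℝ) + 1)) := by gcongr
        _ = _ := by rw [← add_mul, hαβ, one_mul]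
  have hUne : ∀ p, (U p).Nonempty := by
    rintro ⟨s, n⟩
    have hnhds : ∀ᶠ ζ : WeakDual ℝ (StrongDual ℝ F) in 𝓝 ξ,
        ∀ f ∈ s, |ζ f - ξ f| < 1 / ((n : ℝ) + 1) := by
      rw [Finset.eventually_all]
      intro f _
      exact ((WeakDual.eval_continuous f).tendsto ξ).eventually
        (Metric.ball_mem_nhds (ξ f) (by positivity : (0 : ℝ) < 1 / ((n : ℝ) + 1)))
    obtain ⟨ζ, ⟨_, ⟨_, ⟨x, hx, rfl⟩, rfl⟩, rfl⟩, hζ⟩ :=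
      ((mem_closure_iff_frequently.1 hξ).and_eventually hnhds).exists
    obtain ⟨z, hz, e, he, hTx⟩ := exists_mem_Icc_norm_map_sub_le hpos hu hTu
      (mem_closedBall_zero_iff.1 hx)
    refine ⟨z, hz, e, he, fun f hf => ?_⟩
    rw [← hTx]
    exact (hζ f hf).le
  obtain ⟨c, hc⟩ := hw.exists_approx_cluster hw0 hUdir hUconv hUne (fun p z hz => hz.1) hε
  -- The `3ε` consists of `2ε` from the error `e` and `ε` from the approximate cluster point.
  refine ⟨c - T u, lt_of_le_of_lt ?_ hεε'⟩
  refine ContinuousLinearMap.opNorm_le_bound _ (by positivity) fun f => ?_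
  refine le_of_forall_pos_le_add fun δ hδ => ?_
  obtain ⟨n, hn⟩ := exists_nat_one_div_lt hδ
  obtain ⟨c', ⟨-, e, he, hf⟩, hcc'⟩ := hc ({f}, n)
  have h1 := hf f (Finset.mem_singleton_self f)
  have e1 : (ξ' - NormedSpace.inclusionInDoubleDualLi ℝ (c - T u)) f
      = -(f (c' - T u + e) - ξ f) + (f e - f (c - c')) := by
    change ξ f - f (c - T u) = _
    simp only [map_sub, map_add]
    ring
  have h2 : |f e| ≤ ‖f‖ * (2 * ε) := (f.le_opNorm e).trans (by gcongr)
  have h3 : |f (c - c')| ≤ ‖f‖ * ε := (f.le_opNorm _).trans (by gcongr)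
  rw [e1, Real.norm_eq_abs]
  calc _ ≤ |-(f (c' - T u + e) - ξ f)| + |f e - f (c - c')| := abs_add_le _ _
    _ ≤ |f (c' - T u + e) - ξ f| + (|f e| + |f (c - c')|) := by
        rw [abs_neg]
        gcongr
        exact abs_sub _ _
    _ ≤ 1 / ((n : ℝ) + 1) + (‖f‖ * (2 * ε) + ‖f‖ * ε) := by gcongr
    _ ≤ 3 * ε * ‖f‖ + δ := by linarith
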